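/- Let $n\ge 1$ and $N=\{1,\dots,n\}$. A feasible mechanism $M=(q,t)$ consists of Borel maps $q:\mathbb{R}_+^n\to[0,1]^n$ and $t:\mathbb{R}_+^n\to\mathbb{R}_+$ such that, for all $v,v'\in\mathbb{R}_+^n$, $v\cdot q(v)-t(v)\ge v\cdot q(v')-t(v')$ and $v\cdot q(v)-t(v)\ge 0$; $\mathcal{M}$ is the set of feasible mechanisms. For a partition $\mathcal{K}$ of $N$, $M\in\mathcal{M}$ is a $\mathcal{K}$-bundled sales mechanism if for every $K\in\mathcal{K}$ there is a feasible one-item mechanism $(q_K,t_K)$ with $t(v)=\sum_{K\in\mathcal K}t_K(\sum_{j\in K}v_j)$ and $q_i(v)=q_K(\sum_{j\in K}v_j)$ for $i\in K$; it is called separate sales for the finest and pure bundling for the coarsest partition. For a probability distribution $F$ on $\mathbb{R}_+^n$ let $R(M,F)=\int t\,dF$ and $\mu_i(F)=\int v_i\,dF$. Given a set $\mathcal{F}$ of such distributions, $(M^*,F^*)\in\mathcal{M}\times\mathcal{F}$ is a saddle point if $R(M,F^*)\le R(M^*,F^*)\le R(M^*,F)$ for all $M\in\mathcal{M}$, $F\in\mathcal{F}$;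 the optimal revenue guarantee is $\sup_{M\in\mathcal{M}}\inf_{F\in\mathcal{F}}R(M,F)$, and a feasible mechanism that attains it is robustly optimal. A dispersion function is a twice differentiable $\phi:\mathbb{R}\to\mathbb{R}$ with $\phi(0)=0$ and $\phi''\ge\varepsilon$ for some $\varepsilon>0$. Let $H$ be the law on $[1,\infty)$ with distribution function $H(y)=1-1/y$. For $m,s>0$, call $(\alpha,\beta)$ with $0<\alpha<m<\beta$ calibrated to $(\phi,m,s)$ if $$\int_1^\infty \min\{\alpha x,\beta\}\,H(dx)=m,\qquad \int_1^\infty\phi\big(\min\{\alpha x,\beta\}-m\big)\,H(dx)=s,$$ and let $G_{\phi,m,\alpha,\beta}$ be the law on $[\alpha,\beta]$ with density $$g(p)=\lambda\,\frac{\phi'(\beta-m)-\phi'(p-m)}{p},\qquad \lambda=\Big(\int_\alpha^\beta\frac{\phi'(\beta-m)-\phi'(x-m)}{x}\,dx\Big)^{-1}.$$ Fix $m_1,\dots,m_n>0$. (1) Let $\phi_1,\dots,\phi_n$ be dispersion functions, $s_1,\dots,s_n>0$, and let $\mathcal{F}$ be the set of distributions $F$ on $\mathbb{R}_+^n$ with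 $\mu_i(F)=m_i$ and $\mathbb{E}_F[\phi_i(v_i-\mu_i(F))]=s_i$ for all $i$. For every $i$ there is exactly one pair $(\alpha_i,\beta_i)$ calibrated to $(\phi_i,m_i,s_i)$, and $G_i:=G_{\phi_i,m_i,\alpha_i,\beta_i}$ is a probability law. Let $F^*$ be the law of $(\min\{\alpha_i x,\beta_i\})_{i\in N}$, $x\sim H$, and let $M^*$ be the sale of the items separately at independent random prices $p_i\sim G_i$, that is, $q_i^*(v)=G_i(v_i)$ and $t^*(v)=\sum_i\int_{p\le v_i}p\,G_i(dp)$. Then $M^*$ is a separate sales mechanism, $(M^*,F^*)$ is a saddle point with $R(M^*,F^*)=\sum_i\alpha_i$, $M^*$ is robustly optimal, and the optimal revenue guarantee is $\sum_i\alpha_i$. (2) Let $\phi$ be a dispersion function, $s>0$, $m=\sum_i m_i$, and let $\mathcal{F}$ be the set of distributions $F$ on $\mathbb{R}_+^n$ with $\mu_i(F)=m_i$ for all $i$ and $\mathbb{E}_F[\phi(\sum_i v_i-\sum_i\mu_i(F))]=s$. There is exactly one pair $(\alpha,\beta)$ calibrated to $(\phi,m,s)$, and $G:=G_{\phi,m,\alpha,\beta}$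 is a probability law. Let $F^*$ be the law of $\min\{\alpha x,\beta\}\cdot(\frac{m_1}{m},\dots,\frac{m_n}{m})$, $x\sim H$, and let $M^*$ be the sale of the grand bundle at a random price $p\sim G$, that is, $q_i^*(v)=G(\sum_j v_j)$ and $t^*(v)=\int_{p\le\sum_j v_j}p\,G(dp)$. Then $M^*$ is a pure bundling mechanism, $(M^*,F^*)$ is a saddle point with $R(M^*,F^*)=\alpha$, $M^*$ is robustly optimal, and the optimal revenue guarantee is $\alpha$. -/

import Mathlib

open MeasureTheory Set
open scoped NNReal ENNReal

namespace RobustSale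

/-! ### Mechanisms -/

/-- A profile of nonnegative values for `n` items, i.e. a point of `ℝ₊ⁿ`. -/
abbrev Values (n : ℕ) : Type := Fin n → ℝ≥0

/-- A direct mechanism: `q v i` is the probability that a buyer who reports `v` gets item `i`, and
`t v` is the expected payment. -/
structure DirectMechanism (n : ℕ) where
  q : Values n → Fin n → ℝ
  t : Values n → ℝ

/-- The class of feasible mechanisms: Borel measurable allocation rule with values in `[0,1]ⁿ`,
Borel measurable nonnegative payment rule, incentive compatibility, individual rationality. -/
structure DirectMechanism.Feasible {n : ℕ} (M : DirectMechanism n) : Prop where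
  measurable_q : Measurable M.q
  measurable_t : Measurable M.t
  q_mem : ∀ v i, M.q v i ∈ Icc (0 : ℝ) 1
  t_nonneg : ∀ v, 0 ≤ M.t v
  ic : ∀ v w : Values n,
    ∑ i, (v i : ℝ) * M.q w i - M.t w ≤ ∑ i, (v i : ℝ) * M.q v i - M.t v
  ir : ∀ v : Values n, 0 ≤ ∑ i, (v i : ℝ) * M.q v i - M.t v

/-- `M` is a `P`-bundled sales mechanism for a partition `P` of the items: it is feasible and it
sells every bundle `K` of `P` by a feasible one-good mechanism `N K` that is applied to the
bundle value `∑ j ∈ K, v j`. -/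
def IsBundledSales {n : ℕ} (P : Finpartition (Finset.univ : Finset (Fin n)))
    (M : DirectMechanism n) : Prop :=
  M.Feasible ∧ ∃ N : Finset (Fin n) → DirectMechanism 1,
    (∀ K ∈ P.parts, (N K).Feasible) ∧
    (∀ v, M.t v = ∑ K ∈ P.parts, (N K).t (fun _ => ∑ j ∈ K, v j)) ∧
    (∀ v, ∀ K ∈ P.parts, ∀ i ∈ K, M.q v i = (N K).q (fun _ => ∑ j ∈ K, v j) 0)

/-- Separate sales: the case of the finest partition, into singletons. -/
def IsSeparateSales {n : ℕ} (M : DirectMechanism n) : Prop :=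
  IsBundledSales (⊥ : Finpartition (Finset.univ : Finset (Fin n))) M

/-- Pure bundling: the case of the coarsest partition, with the grand bundle as its only part. -/
def IsPureBundling {n : ℕ} (M : DirectMechanism n) : Prop :=
  ∃ P : Finpartition (Finset.univ : Finset (Fin n)), P.parts = {Finset.univ} ∧ IsBundledSales P M

/-! ### Revenue, revenue guarantees, saddle points -/

/-- Expected revenue `R(M,F) = ∫ t dF`. For feasible `M` we have `0 ≤ t v ≤ ∑ i, v i`, so that the
integrand is integrable for every `F` under which the item values have finite means. -/
noncomputable def revenue {n : ℕ} (M : DirectMechanism n) (F : Measure (Values n)) : ℝ :=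
  ∫ v, M.t v ∂F

/-- The revenue guarantee `inf_{F ∈ 𝓕} R(M,F)` of a mechanism. -/
noncomputable def revenueGuarantee {n : ℕ} (𝓕 : Set (Measure (Values n)))
    (M : DirectMechanism n) : EReal :=
  ⨅ F ∈ 𝓕, (revenue M F : EReal)

/-- The optimal revenue guarantee `sup_M inf_{F ∈ 𝓕} R(M,F)`, over all feasible mechanisms. -/
noncomputable def optimalRevenueGuarantee {n : ℕ} (𝓕 : Set (Measure (Values n))) : EReal :=
  ⨆ (M : DirectMechanism n) (_ : M.Feasible), revenueGuarantee 𝓕 M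

/-- A feasible mechanism that attains the optimal revenue guarantee. -/
def IsRobustlyOptimal {n : ℕ} (𝓕 : Set (Measure (Values n))) (M : DirectMechanism n) : Prop :=
  M.Feasible ∧ revenueGuarantee 𝓕 M = optimalRevenueGuarantee 𝓕

/-- `(M, F)` is a saddle point of the zero-sum game between the seller, who chooses a feasible
mechanism, and nature, who chooses a distribution in `𝓕`. -/
structure IsSaddlePoint {n : ℕ} (𝓕 : Set (Measure (Values n))) (M : DirectMechanism n)
    (F : Measure (Values n)) : Prop where
  feasible : M.Feasible
  mem : F ∈ 𝓕
  seller : ∀ M' : DirectMechanism n, M'.Feasible → revenue M' F ≤ revenue M F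
  nature : ∀ F' ∈ 𝓕, revenue M F ≤ revenue M F'

/-! ### Ambiguity sets -/

/-- The mean `μ_i(F)` of the value of item `i`. -/
noncomputable def mean {n : ℕ} (F : Measure (Values n)) (i : Fin n) : ℝ :=
  ∫ v, (v i : ℝ) ∂F

/-- Functions that measure dispersion: twice differentiable, zero at zero, and with second
derivative bounded away from zero from below (in particular strictly convex). -/
structure IsDispersionFunction (φ : ℝ → ℝ) : Prop where
  map_zero : φ 0 = 0
  differentiable : Differentiable ℝ φ
  differentiable_deriv : Differentiable ℝ (deriv φ)
  second_deriv : ∃ ε : ℝ, 0 < ε ∧ ∀ x, ε ≤ deriv (deriv φ) x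

/-- Distributions on `ℝ₊ⁿ` with item means `m i` and item-wise dispersion moments
`E_F[φ_i(v_i - μ_i(F))] = s i`. -/
def itemAmbiguitySet {n : ℕ} (φ : Fin n → ℝ → ℝ) (m s : Fin n → ℝ) :
    Set (Measure (Values n)) :=
  {F | IsProbabilityMeasure F ∧
    ∀ i, Integrable (fun v : Values n => (v i : ℝ)) F ∧ mean F i = m i ∧
      Integrable (fun v : Values n => φ i ((v i : ℝ) - mean F i)) F ∧
      ∫ v : Values n, φ i ((v i : ℝ) - mean F i) ∂F = s i}

/-- Distributions on `ℝ₊ⁿ` with item means `m i` and dispersion moment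
`E_F[φ(∑ i, v_i - ∑ i, μ_i(F))] = s` of the total value. -/
def totalAmbiguitySet {n : ℕ} (φ : ℝ → ℝ) (m : Fin n → ℝ) (s : ℝ) :
    Set (Measure (Values n)) :=
  {F | IsProbabilityMeasure F ∧
    (∀ i, Integrable (fun v : Values n => (v i : ℝ)) F ∧ mean F i = m i) ∧
      Integrable (fun v : Values n => φ (∑ i, (v i : ℝ) - ∑ i, mean F i)) F ∧
      ∫ v : Values n, φ (∑ i, (v i : ℝ) - ∑ i, mean F i) ∂F = s}

/-! ### The candidate saddle points -/

/-- The law on `[1,∞)` with distribution function `H(y) = 1 - 1/y`, i.e. the Pareto law of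
scale `1` and shape `1`. -/
noncomputable def paretoLaw : Measure ℝ := ProbabilityTheory.paretoMeasure 1 1

/-- `(α, β)` with `0 < α < m < β` is calibrated to `(m, s)`: if `x` has law `H`, then
`min (α x) β` has mean `m` and dispersion `s`. -/
structure IsCalibrated (φ : ℝ → ℝ) (m s α β : ℝ) : Prop where
  pos : 0 < α
  lt_mean : α < m
  mean_lt : m < β
  mean_eq : ∫ x, min (α * x) β ∂paretoLaw = m
  dispersion_eq : ∫ x, φ (min (α * x) β - m) ∂paretoLaw = s

/-- The factor `λ = 1 / ∫_α^β (φ'(β - m) - φ'(x - m)) / x dx`. -/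
noncomputable def priceFactor (φ : ℝ → ℝ) (m α β : ℝ) : ℝ :=
  1 / ∫ x in α..β, (deriv φ (β - m) - deriv φ (x - m)) / x

/-- The law `G` of the random price, with density
`g p = λ (φ'(β - m) - φ'(p - m)) / p` on `[α, β]` and `0` elsewhere. -/
noncomputable def priceLaw (φ : ℝ → ℝ) (m α β : ℝ) : Measure ℝ :=
  volume.withDensity fun p => ENNReal.ofReal
    ((Icc α β).indicator
      (fun p => priceFactor φ m α β * ((deriv φ (β - m) - deriv φ (p - m)) / p)) p)

/-- The direct mechanism `q_i(v) = G_i(v_i)`, `t(v) = ∑ i, ∫_{p ≤ v_i} p dG_i(p)`. -/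
noncomputable def separateMechanism {n : ℕ} (G : Fin n → Measure ℝ) : DirectMechanism n where
  q v i := (G i).real (Iic (v i : ℝ))
  t v := ∑ i, ∫ p in Iic (v i : ℝ), p ∂(G i)

/-- The outcome of item prices drawn from a joint law `Q`, when the buyer buys item `i` if and only
if its price is at most its value. -/
noncomputable def randomPriceMechanism {n : ℕ} (Q : Measure (Fin n → ℝ)) :
    DirectMechanism n where
  q v i := Q.real {p | p i ≤ (v i : ℝ)}
  t v := ∫ p, ∑ i, (if p i ≤ (v i : ℝ) then p i else 0) ∂Q

/-- The direct mechanism of a sale of the grand bundle at a random price of law `G`: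
`q_i(v) = G(∑ j, v_j)`, `t(v) = ∫_{p ≤ ∑ j, v_j} p dG(p)`. -/
noncomputable def bundleMechanism {n : ℕ} (G : Measure ℝ) : DirectMechanism n where
  q v _ := G.real (Iic (∑ j, (v j : ℝ)))
  t v := ∫ p in Iic (∑ j, (v j : ℝ)), p ∂G

/-- Separate sales of the items at independent random prices, that of item `i` having the law
`priceLaw (φ i) (m i) (α i) (β i)`. -/
noncomputable def separateOptimal {n : ℕ} (φ : Fin n → ℝ → ℝ) (m α β : Fin n → ℝ) :
    DirectMechanism n :=
  separateMechanism fun i => priceLaw (φ i) (m i) (α i) (β i)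

/-- Sale of the grand bundle at a random price of law `priceLaw φ (∑ i, m i) α β`. -/
noncomputable def bundleOptimal {n : ℕ} (φ : ℝ → ℝ) (m : Fin n → ℝ) (α β : ℝ) :
    DirectMechanism n :=
  bundleMechanism (priceLaw φ (∑ i, m i) α β)

/-- The law of `(min (α_i x) β_i)_i` when `x` has law `H`. -/
noncomputable def separateWorstCase {n : ℕ} (α β : Fin n → ℝ) : Measure (Values n) :=
  paretoLaw.map fun x i => Real.toNNReal (min (α i * x) (β i))

/-- The law of `min (α x) β • (m_i / ∑ j, m_j)_i` when `x` has law `H`. -/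
noncomputable def bundleWorstCase {n : ℕ} (m : Fin n → ℝ) (α β : ℝ) : Measure (Values n) :=
  paretoLaw.map fun x i => Real.toNNReal (min (α * x) β * (m i / ∑ j, m j))

end RobustSale

open RobustSale

namespace RobustSale

open ProbabilityTheory Filter Topology

/-! ### The Pareto law -/

/-! Each half of the saddle point is a bound tight at the candidate pair.

Seller's half (`revenue_separateWorstCase_le`). Under `separateWorstCase` all values move along one
curve `x ↦ v(x)`, with `v_i(x) = min (α_i x) β_i` for `x ≥ 1`, so a mechanism faces a
one-dimensional type `x` of law `H`. For `c > 1`, type `cx` must not gain by posing as `x`. Since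
`v_i(cx) = c v_i(x)` below the truncation, this bounds `(c - 1) t(v(x)) + c u(x) - u(cx)` by a term
living near and above the truncation points, where `u` is the buyer's utility. The density `x⁻²`
makes `E u(cx) ≤ c E u(x)`, so utility drops out. Dividing by `c - 1` and letting `c → 1` bounds
revenue by `∑ α_i`. This finite difference replaces the envelope formula and needs no regularity of
the mechanism along the curve.

Nature's half (`IsCalibrated.le_integral_postedRevenue`). The revenue from a price of law `G` at
value `y` is at least a potential `K(y)`, an affine combination of `y` and `φ(y - m)`, with equality
on `[α, β]`. Hence `E K` is the same for every law with the prescribed mean and dispersion, and the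
truncated Pareto law, carried by `[α, β]`, attains the bound. The factor `λ` makes the common value
`α`. Revenue is additive over items, so only marginals matter in the item-wise case; in the bundled
case the same bound is applied to the total value.

Calibration (`existsUnique_isCalibrated`). The mean condition gives `β = α exp(m/α - 1)`. The
dispersion is then strictly decreasing in `α`, zero at `α = m` and unbounded as `α → 0`.

The bundled worst case is a separate one whose truncation bounds are `α` and `β` times the mean
shares, so the same seller's bound serves both parts. -/

instance isProbabilityMeasure_paretoLaw : IsProbabilityMeasure paretoLaw :=
  isProbabilityMeasure_paretoMeasure one_pos one_pos

theorem rpow_neg_one_add_one (x : ℝ) : x ^ (-(1 + 1) : ℝ) = (x ^ 2)⁻¹ := by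
  rw [show (-(1 + 1) : ℝ) = ((-2 : ℤ) : ℝ) by norm_num, Real.rpow_intCast]
  rfl

theorem toReal_smul_paretoPDF (g : ℝ → ℝ) :
    (fun x => (paretoPDF 1 1 x).toReal • g x) =
      (Ici 1).indicator fun x => (x ^ 2)⁻¹ * g x := by
  funext x
  by_cases hx : 1 ≤ x
  · rw [paretoPDF_of_le hx, indicator_of_mem (show x ∈ Ici (1 : ℝ) from hx), rpow_neg_one_add_one,
      ENNReal.toReal_ofReal (by positivity)]
    simp
  · rw [paretoPDF_of_lt (not_le.mp hx), indicator_of_notMem (show x ∉ Ici (1 : ℝ) from hx)]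
    simp

theorem measurable_paretoPDF : Measurable (paretoPDF 1 1) :=
  (measurable_paretoPDFReal 1 1).ennreal_ofReal

theorem integral_paretoLaw (g : ℝ → ℝ) :
    ∫ x, g x ∂paretoLaw = ∫ x in Ioi 1, (x ^ 2)⁻¹ * g x := by
  rw [paretoLaw, paretoMeasure, integral_withDensity_eq_integral_toReal_smul measurable_paretoPDF
    (ae_of_all _ fun _ => ENNReal.ofReal_lt_top), toReal_smul_paretoPDF,
    integral_indicator measurableSet_Ici, integral_Ici_eq_integral_Ioi]

theorem integrable_paretoLaw_iff (g : ℝ → ℝ) :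
    Integrable g paretoLaw ↔ IntegrableOn (fun x => (x ^ 2)⁻¹ * g x) (Ioi 1) := by
  rw [paretoLaw, paretoMeasure, integrable_withDensity_iff_integrable_smul' measurable_paretoPDF
    (ae_of_all _ fun _ => ENNReal.ofReal_lt_top), toReal_smul_paretoPDF,
    integrable_indicator_iff measurableSet_Ici, integrableOn_Ici_iff_integrableOn_Ioi]

theorem ae_one_le_paretoLaw : ∀ᵐ x ∂paretoLaw, 1 ≤ x := by
  rw [ae_iff, paretoLaw, paretoMeasure, withDensity_apply _ (by measurability)]
  have h := lintegral_paretoPDF_of_le (t := 1) (r := 1) le_rfl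
  convert h using 3
  ext x
  simp

theorem integral_Ioi_sq_inv {y : ℝ} (hy : 0 < y) : ∫ x in Ioi y, (x ^ 2)⁻¹ = y⁻¹ := by
  have h := integral_Ioi_rpow_of_lt (a := -(1 + 1)) (by norm_num) hy
  simp only [rpow_neg_one_add_one] at h
  rw [h, show (-(1 + 1) + 1 : ℝ) = -1 by norm_num, Real.rpow_neg_one]
  ring

theorem integrableOn_Ioi_sq_inv {y : ℝ} (hy : 0 < y) :
    IntegrableOn (fun x : ℝ => (x ^ 2)⁻¹) (Ioi y) := by
  have h := integrableOn_Ioi_rpow_of_lt (a := -(1 + 1)) (by norm_num) hy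
  simpa only [rpow_neg_one_add_one] using h

theorem paretoLaw_real_Ioi_le {y : ℝ} (hy : 0 < y) : paretoLaw.real (Ioi y) ≤ y⁻¹ := by
  rw [← integral_indicator_one measurableSet_Ioi, integral_paretoLaw, ← integral_Ioi_sq_inv hy,
    ← integral_indicator measurableSet_Ioi, ← integral_indicator measurableSet_Ioi]
  -- Equality holds for `y ≥ 1`. For `y < 1` the right side also counts `(y, 1]`, which keeps the
  -- bound valid without comparing `y` to `1`.
  refine integral_mono_of_nonneg (ae_of_all _ fun x => ?_)
    ((integrableOn_Ioi_sq_inv hy).integrable_indicator measurableSet_Ioi) (ae_of_all _ fun x => ?_)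
  · refine indicator_nonneg (fun x _ => mul_nonneg (by positivity) ?_) x
    exact indicator_nonneg (fun _ _ => zero_le_one) x
  · by_cases h1 : x ∈ Ioi y <;> by_cases h2 : x ∈ Ioi (1 : ℝ) <;> simp [h1, h2]
    positivity

/-- The measure `x⁻² dx` is homogeneous of degree `-1`: the law of `c x` is `c` times the Pareto law
cut down to `[c, ∞)`, and what is cut off only helps as `u ≥ 0`. -/
theorem integral_paretoLaw_comp_mul_le {u : ℝ → ℝ} (hu : ∀ x, 0 ≤ u x)
    (hi : Integrable u paretoLaw) {c : ℝ} (hc : 1 ≤ c) :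
    ∫ x, u (c * x) ∂paretoLaw ≤ c * ∫ x, u x ∂paretoLaw := by
  have hc0 : 0 < c := by linarith
  have h := integral_comp_mul_left_Ioi (fun y => c ^ 2 * ((y ^ 2)⁻¹ * u y)) 1 hc0
  rw [integral_paretoLaw, integral_paretoLaw]
  have e : ∀ x, c ^ 2 * (((c * x) ^ 2)⁻¹ * u (c * x)) = (x ^ 2)⁻¹ * u (c * x) := fun x => by
    rw [mul_pow, mul_inv]; field_simp
  simp only [e] at h
  rw [h, integral_const_mul, smul_eq_mul, mul_one, ← mul_assoc,
    show c⁻¹ * c ^ 2 = c by field_simp]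
  refine mul_le_mul_of_nonneg_left ?_ hc0.le
  exact setIntegral_mono_set ((integrable_paretoLaw_iff u).1 hi)
    (ae_of_all _ fun x => mul_nonneg (by positivity) (hu x))
    (Ioi_subset_Ioi hc).eventuallyLE

theorem integrable_comp_min_paretoLaw {ψ : ℝ → ℝ} (hψ : Continuous ψ) {α β : ℝ} (hα : 0 < α)
    (hβ : α ≤ β) : Integrable (fun x => ψ (min (α * x) β)) paretoLaw := by
  obtain ⟨C, hC⟩ := (isCompact_Icc (a := α) (b := β)).exists_bound_of_continuousOn hψ.continuousOn
  refine Integrable.of_bound (by fun_prop) C ?_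
  filter_upwards [ae_one_le_paretoLaw] with x hx
  refine hC _ ⟨le_min ?_ hβ, min_le_right _ _⟩
  nlinarith

/-- Integration by parts: the truncated variable exceeds `p ∈ [α, β)` with probability `α / p`.
Mean, dispersion and posted-price revenue are all computed from this formula. -/
theorem integral_comp_min_paretoLaw {ψ ψ' : ℝ → ℝ} (hψ : ∀ y, HasDerivAt ψ (ψ' y) y)
    (hψ' : Continuous ψ') {α β : ℝ} (hα : 0 < α) (hβ : α ≤ β) :
    ∫ x, ψ (min (α * x) β) ∂paretoLaw = ψ α + α * ∫ p in α..β, ψ' p / p := by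
  have hc : Continuous ψ := continuous_iff_continuousAt.2 fun y => (hψ y).continuousAt
  have hβ0 : 0 < β := hα.trans_le hβ
  have hb : 1 ≤ β / α := by rwa [one_le_div hα]
  have hi := (integrable_paretoLaw_iff _).1 (integrable_comp_min_paretoLaw hc hα hβ)
  -- Truncation sets in at `x = β / α`; beyond it lies the atom at `β`, of mass `α / β`.
  rw [integral_paretoLaw, ← Ioc_union_Ioi_eq_Ioi hb, setIntegral_union
    (Ioc_disjoint_Ioi le_rfl) measurableSet_Ioi (hi.mono_set Ioc_subset_Ioi_self)
    (hi.mono_set (Ioi_subset_Ioi hb))]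
  have e2 : ∫ x in Ioi (β / α), (x ^ 2)⁻¹ * ψ (min (α * x) β) = α / β * ψ β := by
    rw [show α / β = (β / α)⁻¹ from (inv_div β α).symm,
      ← integral_Ioi_sq_inv (y := β / α) (by positivity), ← integral_mul_const]
    refine setIntegral_congr_fun measurableSet_Ioi fun x hx => ?_
    have : β ≤ α * x := by
      have := (div_lt_iff₀ hα).1 (mem_Ioi.1 hx); linarith
    simp only [min_eq_right this]
  have e1 : ∫ x in Ioc 1 (β / α), (x ^ 2)⁻¹ * ψ (min (α * x) β) =
      ∫ x in (1 : ℝ)..(β / α), (x ^ 2)⁻¹ * ψ (α * x) := by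
    rw [intervalIntegral.integral_of_le hb]
    refine setIntegral_congr_fun measurableSet_Ioc fun x hx => ?_
    have : α * x ≤ β := by
      have := (le_div_iff₀ hα).1 hx.2; linarith
    simp only [min_eq_left this]
  have hpos : ∀ x ∈ uIcc 1 (β / α), (0 : ℝ) < x := fun x hx => by
    rw [uIcc_of_le hb] at hx; linarith [hx.1]
  have hd : ∀ x ∈ uIcc 1 (β / α), HasDerivAt (fun x => -(ψ (α * x) / x))
      ((x ^ 2)⁻¹ * ψ (α * x) - α * (α * (ψ' (α * x) / (α * x)))) x := fun x hx => by
    have hx := hpos x hx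
    have h1 : HasDerivAt (fun x => ψ (α * x)) (ψ' (α * x) * (α * 1)) x :=
      (hψ (α * x)).comp x ((hasDerivAt_id x).const_mul α)
    refine (h1.div (hasDerivAt_id x) hx.ne').neg.congr_deriv ?_
    simp only [id]
    field_simp
    ring
  have i1 : IntervalIntegrable (fun x => (x ^ 2)⁻¹ * ψ (α * x)) volume 1 (β / α) := by
    refine ContinuousOn.intervalIntegrable (ContinuousOn.mul (ContinuousOn.inv₀ (by fun_prop) ?_)
      (by fun_prop))
    intro x hx; have := hpos x hx; positivity
  have i2 : IntervalIntegrable (fun x => α * (α * (ψ' (α * x) / (α * x)))) volume 1 (β / α) := by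
    refine ContinuousOn.intervalIntegrable (continuousOn_const.mul (continuousOn_const.mul
      (ContinuousOn.div (by fun_prop) (by fun_prop) ?_)))
    intro x hx; have := hpos x hx; positivity
  have h := intervalIntegral.integral_eq_sub_of_hasDerivAt hd (i1.sub i2)
  rw [intervalIntegral.integral_sub i1 i2, intervalIntegral.integral_const_mul,
    intervalIntegral.integral_const_mul,
    intervalIntegral.mul_integral_comp_mul_left (f := fun p => ψ' p / p), mul_one,
    mul_div_cancel₀ _ hα.ne'] at h
  rw [e1, e2]
  have : ψ β / (β / α) = α / β * ψ β := by field_simp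
  linarith

/-! ### The seller's best reply to a truncated Pareto law -/

theorem DirectMechanism.Feasible.t_le {n : ℕ} {M : DirectMechanism n} (hM : M.Feasible)
    (v : Values n) : M.t v ≤ ∑ i, (v i : ℝ) := by
  have h := hM.ir v
  have : ∑ i, (v i : ℝ) * M.q v i ≤ ∑ i, (v i : ℝ) :=
    Finset.sum_le_sum fun i _ => mul_le_of_le_one_right (v i).2 (hM.q_mem v i).2
  linarith

/-- The value profile that `separateWorstCase` assigns to the state `x`. -/
noncomputable def truncatedProfile {n : ℕ} (α β : Fin n → ℝ) (x : ℝ) : Values n :=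
  fun i => Real.toNNReal (min (α i * x) (β i))

theorem measurable_truncatedProfile {n : ℕ} (α β : Fin n → ℝ) :
    Measurable (truncatedProfile α β) :=
  measurable_pi_lambda _ fun i => by unfold truncatedProfile; fun_prop

theorem coe_truncatedProfile {n : ℕ} {α β : Fin n → ℝ} {i : Fin n} (hα : 0 < α i)
    (hβ : 0 < β i) {x : ℝ} (hx : 0 ≤ x) :
    (truncatedProfile α β x i : ℝ) = min (α i * x) (β i) :=
  Real.coe_toNNReal _ (le_min (by positivity) hβ.le)

theorem coe_truncatedProfile_le {n : ℕ} {α β : Fin n → ℝ} {i : Fin n}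
    (hβ : 0 < β i) (x : ℝ) : (truncatedProfile α β x i : ℝ) ≤ β i := by
  rw [truncatedProfile, Real.coe_toNNReal']
  exact max_le (min_le_right _ _) hβ.le

theorem integral_separateWorstCase {n : ℕ} (α β : Fin n → ℝ) {f : Values n → ℝ}
    (hf : Measurable f) :
    ∫ v, f v ∂(separateWorstCase α β) = ∫ x, f (truncatedProfile α β x) ∂paretoLaw :=
  integral_map (measurable_truncatedProfile α β).aemeasurable hf.aestronglyMeasurable

/-- The gap vanishes as long as `c x` is not truncated; afterwards it is at most `c b - b`. -/
theorem mul_min_sub_min_mul_le {a b c : ℝ} (hb : 0 < b) (hc : 1 ≤ c) (hac : 0 < a) {x : ℝ}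
    (hx : 1 ≤ x) :
    0 ≤ c * min (a * x) b - min (a * (c * x)) b ∧
    c * min (a * x) b - min (a * (c * x)) b ≤
      (c - 1) * (b * (Ioi (b / (c * a))).indicator 1 x) := by
  have hax : 0 < a * x := by positivity
  have e : a * (c * x) = c * (a * x) := by ring
  have hmono : a * x ≤ c * (a * x) := by nlinarith
  constructor
  · rw [e, mul_min_of_nonneg _ _ (by linarith)]
    have : min (c * (a * x)) b ≤ min (c * (a * x)) (c * b) := min_le_min le_rfl (by nlinarith)
    linarith
  · by_cases h : x ∈ Ioi (b / (c * a))
    · rw [indicator_of_mem h, Pi.one_apply]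
      have hbx : b < c * (a * x) := by
        have := (div_lt_iff₀ (by positivity)).1 (mem_Ioi.1 h); linarith
      rw [e, min_eq_right hbx.le]
      have : min (a * x) b ≤ b := min_le_right _ _
      nlinarith
    · have hbx : c * (a * x) ≤ b := by
        have := (le_div_iff₀ (by positivity)).1 (not_lt.1 (mt mem_Ioi.2 h)); linarith
      rw [e, min_eq_left hbx, min_eq_left (hmono.trans hbx), indicator_of_notMem h]
      simp

/-- Only incentive constraints between `x` and `c x` on the support curve are used, with `c` close
to `1`. -/
theorem revenue_separateWorstCase_le {n : ℕ} {α β : Fin n → ℝ} (hα : ∀ i, 0 < α i)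
    (hβ : ∀ i, 0 < β i) {M : DirectMechanism n} (hM : M.Feasible) :
    revenue M (separateWorstCase α β) ≤ ∑ i, α i := by
  have key : ∀ c : ℝ, 1 < c → revenue M (separateWorstCase α β) ≤ c * ∑ i, α i := by
    intro c hc
    rw [revenue, integral_separateWorstCase α β hM.measurable_t]
    set v := truncatedProfile α β with hv
    have hvm : Measurable v := measurable_truncatedProfile α β
    have hvim : ∀ i, Measurable fun x => (v x i : ℝ) := fun i =>
      ((measurable_pi_apply i).comp hvm).coe_nnreal_real
    have hvle : ∀ x, ∑ i, (v x i : ℝ) ≤ ∑ i, β i := fun x =>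
      Finset.sum_le_sum fun i _ => coe_truncatedProfile_le (hβ i) x
    have ht : Measurable fun x => M.t (v x) := hM.measurable_t.comp hvm
    have hq : ∀ i, Measurable fun x => M.q (v x) i := fun i =>
      (measurable_pi_apply i).comp (hM.measurable_q.comp hvm)
    set u : ℝ → ℝ := fun x => ∑ i, (v x i : ℝ) * M.q (v x) i - M.t (v x) with hu
    have hum : Measurable u :=
      (Finset.measurable_sum _ fun i _ => (hvim i).mul (hq i)).sub ht
    have hu0 : ∀ x, 0 ≤ u x := fun x => hM.ir _
    have hule : ∀ x, u x ≤ ∑ i, β i := fun x => by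
      have h1 := hM.t_nonneg (v x)
      have : ∑ i, (v x i : ℝ) * M.q (v x) i ≤ ∑ i, (v x i : ℝ) :=
        Finset.sum_le_sum fun i _ => mul_le_of_le_one_right (v x i).2 (hM.q_mem _ i).2
      have := hvle x
      simp only [hu]
      linarith
    have hti : Integrable (fun x => M.t (v x)) paretoLaw :=
      Integrable.of_bound ht.aestronglyMeasurable (∑ i, β i) (ae_of_all _ fun x => by
        rw [Real.norm_of_nonneg (hM.t_nonneg _)]
        exact (hM.t_le _).trans (hvle x))
    have hui : Integrable u paretoLaw :=
      Integrable.of_bound hum.aestronglyMeasurable (∑ i, β i) (ae_of_all _ fun x => by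
        rw [Real.norm_of_nonneg (hu0 _)]
        exact hule x)
    have huci : Integrable (fun x => u (c * x)) paretoLaw :=
      Integrable.of_bound (hum.comp (measurable_const_mul c)).aestronglyMeasurable (∑ i, β i)
        (ae_of_all _ fun x => by
          rw [Real.norm_of_nonneg (hu0 _)]
          exact hule _)
    have hind : ∀ i, Integrable (fun x => (c - 1) *
        (β i * (Ioi (β i / (c * α i))).indicator (1 : ℝ → ℝ) x)) paretoLaw := fun i =>
      (((integrable_const (1 : ℝ)).indicator measurableSet_Ioi).const_mul _).const_mul _
    have hpt : ∀ᵐ x ∂paretoLaw, (c - 1) * M.t (v x) + c * u x - u (c * x) ≤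
        ∑ i, (c - 1) * (β i * (Ioi (β i / (c * α i))).indicator 1 x) := by
      filter_upwards [ae_one_le_paretoLaw] with x hx
      -- Type `c x` imitates type `x`: the upward deviation that limits how little utility grows
      -- along the curve.
      have hic := hM.ic (v (c * x)) (v x)
      have hb := fun i => mul_min_sub_min_mul_le (hβ i) hc.le (hα i) hx
      have hs : ∑ i, (c * (v x i : ℝ) - (v (c * x) i : ℝ)) * M.q (v x) i ≤
          ∑ i, (c - 1) * (β i * (Ioi (β i / (c * α i))).indicator 1 x) := by
        refine Finset.sum_le_sum fun i _ => ?_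
        rw [hv, coe_truncatedProfile (hα i) (hβ i) (by linarith),
          coe_truncatedProfile (hα i) (hβ i) (by nlinarith)]
        exact (mul_le_of_le_one_right (hb i).1 (hM.q_mem _ i).2).trans (hb i).2
      refine le_trans ?_ hs
      simp only [sub_mul, Finset.sum_sub_distrib, mul_assoc, ← Finset.mul_sum]
      simp only [hu] at hic ⊢
      linarith
    have hI := integral_mono_ae (((hti.const_mul (c - 1)).add (hui.const_mul c)).sub huci)
      (integrable_finsetSum _ fun i _ => hind i) hpt
    rw [integral_sub' ((hti.const_mul (c - 1)).add (hui.const_mul c)) huci,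
      integral_add' (hti.const_mul (c - 1)) (hui.const_mul c), integral_const_mul,
      integral_const_mul, integral_finsetSum _ fun i _ => hind i] at hI
    -- This makes the utility terms `c E u(x) - E u(cx)` nonnegative, so they can be discarded.
    have hsc := integral_paretoLaw_comp_mul_le hu0 hui hc.le
    have hT : ∑ i, ∫ x, (c - 1) * (β i * (Ioi (β i / (c * α i))).indicator (1 : ℝ → ℝ) x)
        ∂paretoLaw ≤ (c - 1) * (c * ∑ i, α i) := by
      rw [Finset.mul_sum, Finset.mul_sum]
      refine Finset.sum_le_sum fun i _ => ?_
      have hαi := hα i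
      have hβi := hβ i
      rw [integral_const_mul, integral_const_mul, integral_indicator_one measurableSet_Ioi]
      -- The tail beyond `β_i / (c α_i)` has mass at most `c α_i / β_i`, which cancels the factor
      -- `β_i`.
      have := paretoLaw_real_Ioi_le (y := β i / (c * α i)) (by positivity)
      refine mul_le_mul_of_nonneg_left ?_ (by linarith)
      calc _ ≤ β i * (β i / (c * α i))⁻¹ := by gcongr
        _ = c * α i := by field_simp
    have : (c - 1) * ∫ x, M.t (v x) ∂paretoLaw ≤ (c - 1) * (c * ∑ i, α i) := by linarith
    exact le_of_mul_le_mul_left this (by linarith)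
  have hlim : Tendsto (fun c : ℝ => c * ∑ i, α i) (𝓝[>] 1) (𝓝 (1 * ∑ i, α i)) :=
    ((continuous_id.mul continuous_const).tendsto 1).mono_left nhdsWithin_le_nhds
  rw [one_mul] at hlim
  exact ge_of_tendsto hlim (eventually_mem_nhdsWithin.mono key)

section

/-! ### Random posted prices -/

/-- The expected revenue from a random price of law `G` when the value is `y`. -/
noncomputable def postedRevenue (G : Measure ℝ) (y : ℝ) : ℝ := ∫ p in Iic y, p ∂G

/-- A law of prices: a probability law with a finite mean on the nonnegative reals. -/
structure IsPriceDistribution (G : Measure ℝ) : Prop where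
  isProbabilityMeasure : IsProbabilityMeasure G
  integrable : Integrable (fun p => p) G
  ae_nonneg : ∀ᵐ p ∂G, 0 ≤ p

namespace IsPriceDistribution

variable {G : Measure ℝ}

theorem postedRevenue_nonneg (hG : IsPriceDistribution G) (y : ℝ) : 0 ≤ postedRevenue G y :=
  integral_nonneg_of_ae (ae_restrict_of_ae hG.ae_nonneg)

theorem monotone_postedRevenue (hG : IsPriceDistribution G) : Monotone (postedRevenue G) :=
  fun _ _ h => setIntegral_mono_set hG.integrable.integrableOn
    (ae_restrict_of_ae hG.ae_nonneg) (Iic_subset_Iic.2 h).eventuallyLE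

theorem monotone_real_Iic (hG : IsPriceDistribution G) : Monotone fun y => G.real (Iic y) :=
  have := hG.isProbabilityMeasure
  fun _ _ h => measureReal_mono (Iic_subset_Iic.2 h)

/-- Reporting `w` amounts to accepting exactly the prices up to `w`. Accepting those up to the true
value `y` maximizes the integrand pointwise, whence `ic` and `ir`. -/
theorem mul_sub_postedRevenue (hG : IsPriceDistribution G) (y w : ℝ) :
    y * G.real (Iic w) - postedRevenue G w = ∫ p, (Iic w).indicator (fun p => y - p) p ∂G := by
  have := hG.isProbabilityMeasure
  rw [integral_indicator measurableSet_Iic, integral_sub (integrable_const _)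
    hG.integrable.integrableOn, integral_const, smul_eq_mul, measureReal_restrict_apply_univ,
    mul_comm y, postedRevenue]

theorem integrable_indicator_sub (hG : IsPriceDistribution G) (y w : ℝ) :
    Integrable ((Iic w).indicator fun p => y - p) G :=
  have := hG.isProbabilityMeasure
  ((integrable_const y).sub hG.integrable).indicator measurableSet_Iic

theorem ic (hG : IsPriceDistribution G) (y w : ℝ) :
    y * G.real (Iic w) - postedRevenue G w ≤ y * G.real (Iic y) - postedRevenue G y := by
  rw [hG.mul_sub_postedRevenue, hG.mul_sub_postedRevenue]
  refine integral_mono (hG.integrable_indicator_sub y w) (hG.integrable_indicator_sub y y)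
    fun p => ?_
  by_cases h1 : p ≤ w <;> by_cases h2 : p ≤ y <;> simp [indicator, h1, h2]
  · exact (not_le.1 h2).le

theorem ir (hG : IsPriceDistribution G) (y : ℝ) :
    0 ≤ y * G.real (Iic y) - postedRevenue G y := by
  rw [hG.mul_sub_postedRevenue]
  refine integral_nonneg fun p => indicator_nonneg (fun p hp => ?_) p
  exact sub_nonneg.2 hp

end IsPriceDistribution

variable {n : ℕ}

theorem separateMechanism_t (G : Fin n → Measure ℝ) (v : Values n) :
    (separateMechanism G).t v = ∑ i, postedRevenue (G i) (v i) := rfl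

theorem bundleMechanism_t (G : Measure ℝ) (v : Values n) :
    (bundleMechanism G).t v = postedRevenue G (∑ i, (v i : ℝ)) := rfl

theorem measurable_coe_apply (i : Fin n) : Measurable fun v : Values n => (v i : ℝ) :=
  (measurable_pi_apply i).coe_nnreal_real

theorem feasible_separateMechanism {G : Fin n → Measure ℝ} (hG : ∀ i, IsPriceDistribution (G i)) :
    (separateMechanism G).Feasible where
  measurable_q := measurable_pi_lambda _ fun i =>
    (hG i).monotone_real_Iic.measurable.comp (measurable_coe_apply i)
  measurable_t := Finset.measurable_sum Finset.univ fun i _ =>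
    (hG i).monotone_postedRevenue.measurable.comp (measurable_coe_apply i)
  q_mem v i :=
    have := (hG i).isProbabilityMeasure
    ⟨measureReal_nonneg, measureReal_le_one⟩
  t_nonneg v := by
    rw [separateMechanism_t]
    exact Finset.sum_nonneg fun i _ => (hG i).postedRevenue_nonneg _
  ic v w := by
    simp only [separateMechanism_t, ← Finset.sum_sub_distrib]
    exact Finset.sum_le_sum fun i _ => (hG i).ic _ _
  ir v := by
    simp only [separateMechanism_t, ← Finset.sum_sub_distrib]
    exact Finset.sum_nonneg fun i _ => (hG i).ir _

theorem feasible_bundleMechanism {G : Measure ℝ} (hG : IsPriceDistribution G) :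
    (bundleMechanism (n := n) G).Feasible where
  measurable_q := measurable_pi_lambda _ fun _ =>
    hG.monotone_real_Iic.measurable.comp
      (Finset.measurable_sum _ fun i _ => measurable_coe_apply i)
  measurable_t := hG.monotone_postedRevenue.measurable.comp
    (Finset.measurable_sum _ fun i _ => measurable_coe_apply i)
  q_mem v i :=
    have := hG.isProbabilityMeasure
    ⟨measureReal_nonneg, measureReal_le_one⟩
  t_nonneg v := hG.postedRevenue_nonneg _
  ic v w := by
    simp only [bundleMechanism, ← Finset.sum_mul]
    exact hG.ic _ _
  ir v := by
    simp only [bundleMechanism, ← Finset.sum_mul]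
    exact hG.ir _

theorem isSeparateSales_separateMechanism (hn : 0 < n) {G : Fin n → Measure ℝ}
    (hG : ∀ i, IsPriceDistribution (G i)) : IsSeparateSales (separateMechanism G) := by
  classical
  -- A singleton is sent to its element. The value at the empty set is a dummy, which needs `0 < n`.
  let item : Finset (Fin n) → Fin n := fun K => if h : K.Nonempty then K.min' h else ⟨0, hn⟩
  have hitem : ∀ i, item {i} = i := fun i => by simp [item]
  refine ⟨feasible_separateMechanism hG, fun K => separateMechanism fun _ => G (item K),
    fun K _ => feasible_separateMechanism fun _ => hG _, fun v => ?_, fun v K hK i hi => ?_⟩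
  · simp [Finpartition.parts_bot, separateMechanism_t, hitem]
  · rw [Finpartition.parts_bot] at hK
    obtain ⟨j, -, rfl⟩ := Finset.mem_map.1 hK
    obtain rfl : i = j := by simpa using hi
    simp [separateMechanism, hitem]

theorem isPureBundling_bundleMechanism (hn : 0 < n) {G : Measure ℝ} (hG : IsPriceDistribution G) :
    IsPureBundling (bundleMechanism (n := n) G) := by
  have hne : (Finset.univ : Finset (Fin n)) ≠ ⊥ :=
    Finset.nonempty_iff_ne_empty.1 ⟨⟨0, hn⟩, Finset.mem_univ _⟩
  refine ⟨Finpartition.indiscrete hne, rfl, feasible_bundleMechanism hG,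
    fun _ => separateMechanism fun _ => G, fun K _ => feasible_separateMechanism fun _ => hG,
    fun v => ?_, fun v K hK i _ => ?_⟩
  · simp [bundleMechanism_t, separateMechanism_t]
  · obtain rfl : K = Finset.univ := by simpa using hK
    simp [bundleMechanism, separateMechanism]

/-- Allocations and expected payments are determined item by item, so only the marginals of the
price vector matter. -/
theorem separateMechanism_eq_randomPriceMechanism {G : Fin n → Measure ℝ}
    (hG : ∀ i, IsPriceDistribution (G i)) :
    separateMechanism G = randomPriceMechanism (Measure.pi G) := by
  have := fun i => (hG i).isProbabilityMeasure
  have hpos : ∀ (v : Values n) i, ∫ p : Fin n → ℝ, (if p i ≤ (v i : ℝ) then p i else 0)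
      ∂(Measure.pi G) = postedRevenue (G i) (v i) ∧
      Integrable (fun p : Fin n → ℝ => if p i ≤ (v i : ℝ) then p i else 0) (Measure.pi G) := by
    intro v i
    have hmp := measurePreserving_eval G i
    have hint : Integrable ((Iic (v i : ℝ)).indicator fun p => p) (G i) :=
      (hG i).integrable.indicator measurableSet_Iic
    constructor
    · have hm : AEStronglyMeasurable ((Iic (v i : ℝ)).indicator fun p => p)
          ((Measure.pi G).map (Function.eval i)) :=
        (measurable_id.indicator measurableSet_Iic).aestronglyMeasurable
      rw [postedRevenue, ← integral_indicator measurableSet_Iic, ← hmp.map_eq,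
        integral_map hmp.measurable.aemeasurable hm]
      rfl
    · exact hmp.integrable_comp_of_integrable hint
  simp only [separateMechanism, randomPriceMechanism, DirectMechanism.mk.injEq]
  constructor
  · funext v i
    have hmp := measurePreserving_eval G i
    exact (hmp.measureReal_preimage measurableSet_Iic.nullMeasurableSet).symm
  · funext v
    rw [integral_finsetSum _ fun i _ => (hpos v i).2]
    exact Finset.sum_congr rfl fun i _ => (hpos v i).1.symm

/-! ### Saddle points -/

theorem IsSaddlePoint.revenueGuarantee_eq {𝓕 : Set (Measure (Values n))} {M : DirectMechanism n}
    {F : Measure (Values n)} (h : IsSaddlePoint 𝓕 M F) :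
    revenueGuarantee 𝓕 M = (revenue M F : EReal) :=
  le_antisymm (iInf₂_le F h.mem)
    (le_iInf₂ fun F' hF' => EReal.coe_le_coe_iff.2 (h.nature F' hF'))

/-- Weak duality: the guarantee of any mechanism is at most its revenue at the saddle distribution.
-/
theorem IsSaddlePoint.optimalRevenueGuarantee_eq {𝓕 : Set (Measure (Values n))}
    {M : DirectMechanism n} {F : Measure (Values n)} (h : IsSaddlePoint 𝓕 M F) :
    optimalRevenueGuarantee 𝓕 = (revenue M F : EReal) :=
  le_antisymm
    (iSup₂_le fun M' hM' => (iInf₂_le F h.mem).trans (EReal.coe_le_coe_iff.2 (h.seller M' hM')))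
    (h.revenueGuarantee_eq ▸ le_iSup₂ (f := fun M _ => revenueGuarantee 𝓕 M) M h.feasible)

theorem IsSaddlePoint.isRobustlyOptimal {𝓕 : Set (Measure (Values n))}
    {M : DirectMechanism n} {F : Measure (Values n)} (h : IsSaddlePoint 𝓕 M F) :
    IsRobustlyOptimal 𝓕 M :=
  ⟨h.feasible, h.revenueGuarantee_eq.trans h.optimalRevenueGuarantee_eq.symm⟩

end

section

/-! ### Calibration -/

namespace IsDispersionFunction

variable {φ : ℝ → ℝ}

theorem strictMono_deriv (hφ : IsDispersionFunction φ) : StrictMono (deriv φ) := by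
  obtain ⟨ε, hε, h⟩ := hφ.second_deriv
  exact strictMono_of_deriv_pos fun x => hε.trans_le (h x)

theorem continuous_deriv (hφ : IsDispersionFunction φ) : Continuous (deriv φ) :=
  hφ.differentiable_deriv.continuous

theorem hasDerivAt_comp_sub (hφ : IsDispersionFunction φ) (m y : ℝ) :
    HasDerivAt (fun y => φ (y - m)) (deriv φ (y - m)) y :=
  (hφ.differentiable (y - m)).hasDerivAt.comp_sub_const y m

/-- Subtracting the tangent at `0` and a small enough quadratic leaves a function whose derivative
is monotone and zero at `0`, so it is minimal there. -/
theorem exists_quadratic_le (hφ : IsDispersionFunction φ) :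
    ∃ ε : ℝ, 0 < ε ∧ ∀ x, deriv φ 0 * x + ε * x ^ 2 ≤ φ x := by
  obtain ⟨ε, hε, h⟩ := hφ.second_deriv
  refine ⟨ε / 2, by positivity, fun x => ?_⟩
  let g : ℝ → ℝ := fun x => φ x - (deriv φ 0 * x + ε / 2 * x ^ 2)
  have hg : ∀ x, HasDerivAt g (deriv φ x - (deriv φ 0 + ε * x)) x := fun x => by
    refine ((hφ.differentiable x).hasDerivAt.sub (((hasDerivAt_id x).const_mul (deriv φ 0)).add
      (((hasDerivAt_id x).pow 2).const_mul (ε / 2)))).congr_deriv ?_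
    simp; ring
  have hmono : Monotone fun x => deriv φ x - (deriv φ 0 + ε * x) := by
    have hd : ∀ x, HasDerivAt (fun x => deriv φ x - (deriv φ 0 + ε * x))
        (deriv (deriv φ) x - ε) x := fun x => by
      refine ((hφ.differentiable_deriv x).hasDerivAt.sub
        (((hasDerivAt_id x).const_mul ε).const_add (deriv φ 0))).congr_deriv ?_
      simp
    refine monotone_of_deriv_nonneg (fun x => (hd x).differentiableAt) fun x => ?_
    rw [(hd x).deriv]
    linarith [h x]
  have hcont : Continuous g := continuous_iff_continuousAt.2 fun x => (hg x).continuousAt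
  have h0 : g 0 = 0 := by simp [g, hφ.map_zero]
  have hgx : 0 ≤ g x := by
    rcases le_total 0 x with hx | hx
    · have : MonotoneOn g (Ici 0) := monotoneOn_of_deriv_nonneg (convex_Ici 0) hcont.continuousOn
        (fun x _ => (hg x).differentiableAt.differentiableWithinAt) fun y hy => by
          rw [interior_Ici] at hy
          have := hmono (mem_Ioi.1 hy).le
          simp only [mul_zero, add_zero, sub_self] at this
          rwa [(hg y).deriv]
      exact h0 ▸ this (mem_Ici.2 le_rfl) hx hx
    · have : AntitoneOn g (Iic 0) := antitoneOn_of_deriv_nonpos (convex_Iic 0) hcont.continuousOn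
        (fun x _ => (hg x).differentiableAt.differentiableWithinAt) fun y hy => by
          rw [interior_Iic] at hy
          have := hmono (mem_Iio.1 hy).le
          simp only [mul_zero, add_zero, sub_self] at this
          rwa [(hg y).deriv]
      exact h0 ▸ this hx (mem_Iic.2 le_rfl) hx
  simp only [g] at hgx
  linarith

theorem deriv_gap_pos (hφ : IsDispersionFunction φ) (m : ℝ) {α β : ℝ} (hα : 0 < α)
    (hαβ : α < β) : 0 < ∫ x in α..β, (deriv φ (β - m) - deriv φ (x - m)) / x := by
  have hc := hφ.continuous_deriv
  refine intervalIntegral.intervalIntegral_pos_of_pos_on ?_ (fun x hx => ?_) hαβ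
  · refine ContinuousOn.intervalIntegrable (ContinuousOn.div (by fun_prop) (by fun_prop) ?_)
    intro x hx
    rw [uIcc_of_le hαβ.le] at hx
    exact (hα.trans_le hx.1).ne'
  · exact div_pos (sub_pos.2 (hφ.strictMono_deriv (by linarith [hx.2]))) (hα.trans hx.1)

end IsDispersionFunction

/-- The upper end of the truncated Pareto law with lower end `α` and mean `m`. -/
noncomputable def upperEnd (m α : ℝ) : ℝ := α * Real.exp (m / α - 1)

theorem upperEnd_pos {m α : ℝ} (hα : 0 < α) : 0 < upperEnd m α := by
  unfold upperEnd; positivity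

theorem upperEnd_self {m : ℝ} (hm : 0 < m) : upperEnd m m = m := by
  simp [upperEnd, hm.ne']

theorem lt_upperEnd {m α : ℝ} (hα : 0 < α) (hαm : α < m) : m < upperEnd m α := by
  have h : (1 : ℝ) < m / α := (one_lt_div hα).2 hαm
  have := Real.add_one_lt_exp (x := m / α - 1) (by linarith)
  rw [sub_add_cancel] at this
  calc m = α * (m / α) := by field_simp
    _ < upperEnd m α := by unfold upperEnd; gcongr

theorem integral_min_paretoLaw {α β : ℝ} (hα : 0 < α) (hβ : α ≤ β) :
    ∫ x, min (α * x) β ∂paretoLaw = α + α * Real.log (β / α) := by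
  have h := integral_comp_min_paretoLaw (ψ := fun y => y) (fun y => hasDerivAt_id y)
    continuous_const hα hβ
  rw [h, integral_one_div_of_pos hα (hα.trans_le hβ)]

theorem integral_min_paretoLaw_eq_iff {m α β : ℝ} (hα : 0 < α) (hβ : α ≤ β) :
    ∫ x, min (α * x) β ∂paretoLaw = m ↔ β = upperEnd m α := by
  have hβ0 := hα.trans_le hβ
  rw [integral_min_paretoLaw hα hβ]
  constructor
  · rintro rfl
    rw [upperEnd, show (α + α * Real.log (β / α)) / α - 1 = Real.log (β / α) by field_simp; ring,
      Real.exp_log (by positivity)]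
    field_simp
  · intro h
    rw [h, upperEnd, mul_div_cancel_left₀ _ hα.ne', Real.log_exp]
    field_simp
    ring

/-- The dispersion of the truncated Pareto law with lower end `α` and mean `m`. -/
noncomputable def truncatedDispersion (φ : ℝ → ℝ) (m α : ℝ) : ℝ :=
  φ (α - m) + α * ∫ p in α..upperEnd m α, deriv φ (p - m) / p

variable {φ : ℝ → ℝ}

theorem isCalibrated_iff (hφ : IsDispersionFunction φ) {m s α β : ℝ} :
    IsCalibrated φ m s α β ↔
      0 < α ∧ α < m ∧ β = upperEnd m α ∧ truncatedDispersion φ m α = s := by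
  have hc := hφ.continuous_deriv
  have hdisp : ∀ {α β : ℝ}, 0 < α → α ≤ β → ∫ x, φ (min (α * x) β - m) ∂paretoLaw =
      φ (α - m) + α * ∫ p in α..β, deriv φ (p - m) / p := fun hα hβ =>
    integral_comp_min_paretoLaw (hφ.hasDerivAt_comp_sub m) (by fun_prop) hα hβ
  constructor
  · intro h
    have hle := (h.lt_mean.trans h.mean_lt).le
    have hβ := (integral_min_paretoLaw_eq_iff h.pos hle).1 h.mean_eq
    refine ⟨h.pos, h.lt_mean, hβ, ?_⟩
    rw [truncatedDispersion, ← hβ, ← hdisp h.pos hle, h.dispersion_eq]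
  · rintro ⟨hα, hαm, rfl, hs⟩
    have hlt := lt_upperEnd hα hαm
    have hle := (hαm.trans hlt).le
    exact ⟨hα, hαm, hlt, (integral_min_paretoLaw_eq_iff hα hle).2 rfl,
      (hdisp hα hle).trans hs⟩

/-- The terms `φ'(α - m)` cancel. Since `α β'/β = 1 - m/α = -log(β/α)`, the moving upper end
contributes `-∫ φ'(β - m)/x`. -/
theorem hasDerivAt_truncatedDispersion (hφ : IsDispersionFunction φ) {m α : ℝ} (hm : 0 < m)
    (hα : 0 < α) : HasDerivAt (truncatedDispersion φ m)
      (-∫ x in α..upperEnd m α, (deriv φ (upperEnd m α - m) - deriv φ (x - m)) / x) α := by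
  have hc := hφ.continuous_deriv
  have hint : ∀ {a b : ℝ}, 0 < a → 0 < b →
      IntervalIntegrable (fun p => deriv φ (p - m) / p) volume a b := fun {a b} ha hb => by
    refine ContinuousOn.intervalIntegrable (ContinuousOn.div (by fun_prop) (by fun_prop) ?_)
    intro x hx
    exact ((lt_min ha hb).trans_le hx.1).ne'
  -- Both ends of the integral move with `α`, so it is written as a difference of integrals from the
  -- fixed base point `m`.
  have hP : ∀ y, 0 < y → HasDerivAt (fun y => ∫ p in m..y, deriv φ (p - m) / p)
      (deriv φ (y - m) / y) y := fun y hy => by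
    have hm1 : Measurable fun p => deriv φ (p - m) / p :=
      (hc.measurable.comp (measurable_id.sub_const m)).div measurable_id
    refine intervalIntegral.integral_hasDerivAt_right (hint hm hy)
      hm1.stronglyMeasurable.stronglyMeasurableAtFilter ?_
    exact ContinuousAt.div (by fun_prop) (by fun_prop) hy.ne'
  have hβ : HasDerivAt (upperEnd m) ((1 - m / α) * (upperEnd m α / α)) α := by
    have h1 : HasDerivAt (fun a => m / a - 1) (-m / α ^ 2) α := by
      refine (((hasDerivAt_const α m).div (hasDerivAt_id α) hα.ne').sub_const 1).congr_deriv ?_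
      simp
    refine ((hasDerivAt_id α).mul h1.exp).congr_deriv ?_
    simp only [upperEnd, id]
    field_simp
    ring
  have hβ0 := upperEnd_pos (m := m) hα
  have hmain := ((hφ.hasDerivAt_comp_sub m α).add ((hasDerivAt_id α).mul
    (((hP _ hβ0).comp α hβ).sub (hP α hα))))
  have hev : truncatedDispersion φ m =ᶠ[𝓝 α] ((fun y => φ (y - m)) + id *
      (((fun y => ∫ p in m..y, deriv φ (p - m) / p) ∘ upperEnd m) -
        fun y => ∫ p in m..y, deriv φ (p - m) / p)) := by
    filter_upwards [lt_mem_nhds hα] with a ha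
    simp only [truncatedDispersion, Pi.add_apply, Pi.mul_apply, Pi.sub_apply, id,
      Function.comp_apply]
    rw [intervalIntegral.integral_interval_sub_left (hint hm (upperEnd_pos ha)) (hint hm ha)]
  refine (hmain.congr_of_eventuallyEq hev).congr_deriv ?_
  simp only [id, Pi.sub_apply, Function.comp_apply, sub_div]
  rw [intervalIntegral.integral_interval_sub_left (hint hm hβ0) (hint hm hα),
    intervalIntegral.integral_sub _ (hint hα hβ0)]
  · have hlog : ∫ x in α..upperEnd m α, deriv φ (upperEnd m α - m) / x =
        deriv φ (upperEnd m α - m) * (m / α - 1) := by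
      simp only [div_eq_mul_one_div (deriv φ (upperEnd m α - m))]
      rw [intervalIntegral.integral_const_mul, integral_one_div_of_pos hα hβ0]
      rw [show upperEnd m α / α = Real.exp (m / α - 1) by
        rw [upperEnd, mul_div_cancel_left₀ _ hα.ne'], Real.log_exp]
    rw [hlog]
    field_simp
    ring
  · refine ContinuousOn.intervalIntegrable (ContinuousOn.div (by fun_prop) (by fun_prop) ?_)
    intro x hx
    exact ((lt_min hα hβ0).trans_le hx.1).ne'

theorem continuousOn_truncatedDispersion (hφ : IsDispersionFunction φ) {m : ℝ} (hm : 0 < m) :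
    ContinuousOn (truncatedDispersion φ m) (Ioc 0 m) := fun _ hα =>
  (hasDerivAt_truncatedDispersion hφ hm hα.1).continuousAt.continuousWithinAt

theorem strictAntiOn_truncatedDispersion (hφ : IsDispersionFunction φ) {m : ℝ} (hm : 0 < m) :
    StrictAntiOn (truncatedDispersion φ m) (Ioc 0 m) := by
  refine strictAntiOn_of_deriv_neg (convex_Ioc 0 m) (continuousOn_truncatedDispersion hφ hm)
    fun α hα => ?_
  rw [interior_Ioc] at hα
  rw [(hasDerivAt_truncatedDispersion hφ hm hα.1).deriv, neg_lt_zero]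
  exact hφ.deriv_gap_pos m hα.1 (hα.2.trans (lt_upperEnd hα.1 hα.2))

theorem truncatedDispersion_self (hφ : IsDispersionFunction φ) {m : ℝ} (hm : 0 < m) :
    truncatedDispersion φ m m = 0 := by
  simp [truncatedDispersion, upperEnd_self hm, hφ.map_zero]

/-- Strong convexity bounds the dispersion below by a multiple of the variance, which blows up as `α
→ 0`. -/
theorem exists_lt_truncatedDispersion (hφ : IsDispersionFunction φ) {m : ℝ} (hm : 0 < m) (s : ℝ) :
    ∃ α, 0 < α ∧ α < m ∧ s < truncatedDispersion φ m α := by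
  have hc := hφ.continuous_deriv
  obtain ⟨ε, hε, hquad⟩ := hφ.exists_quadratic_le
  -- The tangent term vanishes at mean `m`. The second moment is `2αβ - α²`, so the bracket is the
  -- variance.
  have hlow : ∀ α, 0 < α → α < m →
      ε * (2 * α * upperEnd m α - α ^ 2 - m ^ 2) ≤ truncatedDispersion φ m α := by
    intro α hα hαm
    have hle := (hαm.trans (lt_upperEnd hα hαm)).le
    have hmean := (integral_min_paretoLaw_eq_iff (m := m) hα hle).2 rfl
    have hψ : ∀ y, HasDerivAt (fun y => deriv φ 0 * (y - m) + ε * (y - m) ^ 2)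
        (deriv φ 0 + 2 * ε * (y - m)) y := fun y => by
      refine ((((hasDerivAt_id y).sub_const m).const_mul (deriv φ 0)).add
        ((((hasDerivAt_id y).sub_const m).pow 2).const_mul ε)).congr_deriv ?_
      simp; ring
    have h1 := integral_comp_min_paretoLaw hψ (by fun_prop) hα hle
    have h2 := integral_comp_min_paretoLaw (hφ.hasDerivAt_comp_sub m) (by fun_prop) hα hle
    have h3 : ∫ x, deriv φ 0 * (min (α * x) (upperEnd m α) - m) +
        ε * (min (α * x) (upperEnd m α) - m) ^ 2 ∂paretoLaw ≤ truncatedDispersion φ m α := by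
      rw [truncatedDispersion, ← h2]
      refine integral_mono
        (integrable_comp_min_paretoLaw (ψ := fun y => deriv φ 0 * (y - m) + ε * (y - m) ^ 2)
          (by fun_prop) hα hle)
        (integrable_comp_min_paretoLaw (ψ := fun y => φ (y - m)) ?_ hα hle) fun x => hquad _
      exact hφ.differentiable.continuous.comp (continuous_id.sub continuous_const)
    rw [h1] at h3
    have hβ0 := upperEnd_pos (m := m) hα
    have e : ∫ p in α..upperEnd m α, (deriv φ 0 + 2 * ε * (p - m)) / p =
        (deriv φ 0 - 2 * ε * m) * (m / α - 1) + 2 * ε * (upperEnd m α - α) := by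
      have e1 : ∫ p in α..upperEnd m α, (deriv φ 0 + 2 * ε * (p - m)) / p =
          ∫ p in α..upperEnd m α, ((deriv φ 0 - 2 * ε * m) * (1 / p) + 2 * ε) := by
        refine intervalIntegral.integral_congr fun p hp => ?_
        have : p ≠ 0 := ((lt_min hα hβ0).trans_le hp.1).ne'
        field_simp
        ring
      have hi : IntervalIntegrable (fun p : ℝ => 1 / p) volume α (upperEnd m α) := by
        refine ContinuousOn.intervalIntegrable (ContinuousOn.div (by fun_prop) (by fun_prop) ?_)
        intro x hx
        exact ((lt_min hα hβ0).trans_le hx.1).ne'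
      rw [e1, intervalIntegral.integral_add (hi.const_mul _) (by simp),
        intervalIntegral.integral_const_mul, integral_one_div_of_pos hα hβ0,
        show upperEnd m α / α = Real.exp (m / α - 1) by
          rw [upperEnd, mul_div_cancel_left₀ _ hα.ne'], Real.log_exp,
        intervalIntegral.integral_const, smul_eq_mul]
      ring
    rw [e] at h3
    refine le_trans (le_of_eq ?_) h3
    field_simp
    ring
  have hlim : Tendsto (fun α : ℝ => ε * (2 * α * upperEnd m α - α ^ 2 - m ^ 2)) (𝓝[>] 0)
      atTop := by
    have hx : Tendsto (fun α : ℝ => m / α) (𝓝[>] 0) atTop := by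
      simpa only [div_eq_mul_inv] using tendsto_inv_nhdsGT_zero.const_mul_atTop hm
    -- With `x = m/α`, the product `2αβ` equals `2 m² e⁻¹ · eˣ/x²`.
    have he := ((Real.tendsto_exp_div_pow_atTop 2).comp hx).const_mul_atTop
      (show 0 < 2 * m ^ 2 * Real.exp (-1) by positivity)
    have hα0 : Tendsto (fun α : ℝ => -(α ^ 2) - m ^ 2) (𝓝[>] 0) (𝓝 (-(0 ^ 2) - m ^ 2)) :=
      (Continuous.tendsto (by fun_prop) 0).mono_left nhdsWithin_le_nhds
    refine ((he.atTop_add hα0).const_mul_atTop hε).congr' ?_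
    filter_upwards [self_mem_nhdsWithin] with α hα
    have hα : α ≠ 0 := (mem_Ioi.1 hα).ne'
    simp only [Function.comp_apply, upperEnd, sub_eq_add_neg (m / α), Real.exp_add]
    field_simp
    ring
  obtain ⟨α, hsα, hα0, hαm⟩ := ((hlim.eventually_gt_atTop s).and
    (eventually_mem_nhdsWithin.and (nhdsWithin_le_nhds (gt_mem_nhds hm)))).exists
  exact ⟨α, hα0, hαm, hsα.trans_le (hlow α hα0 hαm)⟩

theorem existsUnique_isCalibrated (hφ : IsDispersionFunction φ) {m s : ℝ} (hm : 0 < m)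
    (hs : 0 < s) : ∃! p : ℝ × ℝ, IsCalibrated φ m s p.1 p.2 := by
  obtain ⟨a, ha0, ham, ha⟩ := exists_lt_truncatedDispersion hφ hm s
  have hivt := intermediate_value_Icc' ham.le ((continuousOn_truncatedDispersion hφ hm).mono
    (fun x hx => ⟨ha0.trans_le hx.1, hx.2⟩ : Icc a m ⊆ Ioc 0 m))
  rw [truncatedDispersion_self hφ hm] at hivt
  obtain ⟨α, hα, hαs⟩ := hivt ⟨hs.le, ha.le⟩
  have hα0 := ha0.trans_le hα.1
  have hαm : α < m := hα.2.lt_of_ne fun h => by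
    rw [h, truncatedDispersion_self hφ hm] at hαs
    exact hs.ne hαs
  refine ⟨(α, upperEnd m α), (isCalibrated_iff hφ).2 ⟨hα0, hαm, rfl, hαs⟩, ?_⟩
  rintro ⟨α', β'⟩ h
  obtain ⟨h0, h1, hβ', h2⟩ := (isCalibrated_iff hφ).1 h
  dsimp only at h0 h1 hβ' h2
  subst hβ'
  obtain rfl : α' = α := (strictAntiOn_truncatedDispersion hφ hm).injOn ⟨h0, h1.le⟩
    ⟨hα0, hαm.le⟩ (h2.trans hαs.symm)
  rfl

end

/-! ### The law of the random price -/

section PriceLaw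

variable {φ : ℝ → ℝ} {m α β : ℝ}

/-- The density of `priceLaw` on the whole line. -/
noncomputable def priceDensity (φ : ℝ → ℝ) (m α β : ℝ) : ℝ → ℝ :=
  (Icc α β).indicator fun p => priceFactor φ m α β * ((deriv φ (β - m) - deriv φ (p - m)) / p)

theorem priceFactor_pos (hφ : IsDispersionFunction φ) (hα : 0 < α) (hαβ : α < β) :
    0 < priceFactor φ m α β :=
  one_div_pos.2 (hφ.deriv_gap_pos m hα hαβ)

theorem priceDensity_nonneg (hφ : IsDispersionFunction φ) (hα : 0 < α) (hαβ : α < β) (p : ℝ) :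
    0 ≤ priceDensity φ m α β p := by
  refine indicator_nonneg (fun p hp => ?_) p
  have hp0 : 0 < p := hα.trans_le hp.1
  have := hφ.strictMono_deriv.monotone (sub_le_sub_right hp.2 m)
  exact mul_nonneg (priceFactor_pos hφ hα hαβ).le (div_nonneg (by linarith) hp0.le)

theorem measurable_priceDensity (hφ : IsDispersionFunction φ) :
    Measurable (priceDensity φ m α β) := by
  have hc := hφ.continuous_deriv
  refine Measurable.indicator (Measurable.const_mul (Measurable.div ?_ measurable_id) _)
    measurableSet_Icc
  exact Continuous.measurable (by fun_prop)

theorem integrable_priceDensity (hφ : IsDispersionFunction φ) (hα : 0 < α) :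
    Integrable (priceDensity φ m α β) := by
  have hc := hφ.continuous_deriv
  refine (integrable_indicator_iff measurableSet_Icc).2 (ContinuousOn.integrableOn_Icc ?_)
  refine continuousOn_const.mul (ContinuousOn.div (by fun_prop) (by fun_prop) fun x hx => ?_)
  exact (hα.trans_le hx.1).ne'

theorem integral_priceLaw (hφ : IsDispersionFunction φ) (hα : 0 < α) (hαβ : α < β) (g : ℝ → ℝ) :
    ∫ p, g p ∂(priceLaw φ m α β) = ∫ p, priceDensity φ m α β p * g p := by
  have h := integral_withDensity_eq_integral_toReal_smul (μ := volume)
    (measurable_priceDensity (m := m) (α := α) (β := β) hφ).ennreal_ofReal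
    (ae_of_all _ fun _ => ENNReal.ofReal_lt_top) g
  simp only [ENNReal.toReal_ofReal (priceDensity_nonneg hφ hα hαβ _), smul_eq_mul] at h
  exact h

theorem isProbabilityMeasure_priceLaw (hφ : IsDispersionFunction φ) (hα : 0 < α) (hαβ : α < β) :
    IsProbabilityMeasure (priceLaw φ m α β) := by
  constructor
  have h : priceLaw φ m α β univ = ∫⁻ p, ENNReal.ofReal (priceDensity φ m α β p) := by
    rw [priceLaw, withDensity_apply _ MeasurableSet.univ, Measure.restrict_univ]
    rfl
  rw [h, ← ofReal_integral_eq_lintegral_ofReal (integrable_priceDensity hφ hα)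
    (ae_of_all _ (priceDensity_nonneg hφ hα hαβ)), priceDensity,
    integral_indicator measurableSet_Icc, integral_Icc_eq_integral_Ioc,
    ← intervalIntegral.integral_of_le hαβ.le, intervalIntegral.integral_const_mul, priceFactor,
    one_div_mul_cancel (hφ.deriv_gap_pos m hα hαβ).ne', ENNReal.ofReal_one]

theorem ae_mem_Icc_priceLaw : ∀ᵐ p ∂(priceLaw φ m α β), p ∈ Icc α β := by
  change priceLaw φ m α β (Icc α β)ᶜ = 0
  rw [priceLaw, withDensity_apply _ measurableSet_Icc.compl]
  refine (setLIntegral_congr_fun (g := fun _ => 0) measurableSet_Icc.compl fun p hp => ?_).trans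
    (by simp)
  simp only [indicator_of_notMem hp, ENNReal.ofReal_zero]

theorem isPriceDistribution_priceLaw (hφ : IsDispersionFunction φ) (hα : 0 < α) (hαβ : α < β) :
    IsPriceDistribution (priceLaw φ m α β) where
  isProbabilityMeasure := isProbabilityMeasure_priceLaw hφ hα hαβ
  integrable := by
    have := isProbabilityMeasure_priceLaw (m := m) hφ hα hαβ
    refine Integrable.of_bound measurable_id.aestronglyMeasurable β ?_
    filter_upwards [ae_mem_Icc_priceLaw] with p hp
    rw [Real.norm_of_nonneg (hα.le.trans hp.1)]
    exact hp.2
  ae_nonneg := ae_mem_Icc_priceLaw.mono fun _ hp => hα.le.trans hp.1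

/-- The potential that minorizes the revenue from a random price of law `priceLaw φ m α β`. -/
noncomputable def pricePotential (φ : ℝ → ℝ) (m α β y : ℝ) : ℝ :=
  priceFactor φ m α β * (deriv φ (β - m) * (y - α) - (φ (y - m) - φ (α - m)))

/-- On `[α, β]` this derivative is the price times its density, so there the potential accumulates
posted-price revenue; its sign changes at `β`. -/
theorem hasDerivAt_pricePotential (hφ : IsDispersionFunction φ) (y : ℝ) :
    HasDerivAt (pricePotential φ m α β)
      (priceFactor φ m α β * (deriv φ (β - m) - deriv φ (y - m))) y := by
  refine ((((hasDerivAt_id y).sub_const α).const_mul (deriv φ (β - m))).sub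
    ((hφ.hasDerivAt_comp_sub m y).sub_const _)).const_mul _ |>.congr_deriv ?_
  rw [mul_one]

theorem pricePotential_left : pricePotential φ m α β α = 0 := by simp [pricePotential]

theorem continuous_pricePotential (hφ : IsDispersionFunction φ) :
    Continuous (pricePotential φ m α β) :=
  continuous_iff_continuousAt.2 fun y => (hasDerivAt_pricePotential hφ y).continuousAt

theorem monotoneOn_pricePotential (hφ : IsDispersionFunction φ) (hα : 0 < α) (hαβ : α < β) :
    MonotoneOn (pricePotential φ m α β) (Iic β) := by
  refine monotoneOn_of_deriv_nonneg (convex_Iic β) (continuous_pricePotential hφ).continuousOn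
    (fun x _ => (hasDerivAt_pricePotential hφ x).differentiableAt.differentiableWithinAt)
    fun y hy => ?_
  rw [interior_Iic] at hy
  rw [(hasDerivAt_pricePotential hφ y).deriv]
  exact mul_nonneg (priceFactor_pos hφ hα hαβ).le
    (sub_nonneg.2 (hφ.strictMono_deriv.monotone (sub_le_sub_right (mem_Iio.1 hy).le m)))

theorem antitoneOn_pricePotential (hφ : IsDispersionFunction φ) (hα : 0 < α) (hαβ : α < β) :
    AntitoneOn (pricePotential φ m α β) (Ici β) := by
  refine antitoneOn_of_deriv_nonpos (convex_Ici β) (continuous_pricePotential hφ).continuousOn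
    (fun x _ => (hasDerivAt_pricePotential hφ x).differentiableAt.differentiableWithinAt)
    fun y hy => ?_
  rw [interior_Ici] at hy
  rw [(hasDerivAt_pricePotential hφ y).deriv]
  exact mul_nonpos_of_nonneg_of_nonpos (priceFactor_pos hφ hα hαβ).le
    (sub_nonpos.2 (hφ.strictMono_deriv.monotone (sub_le_sub_right (mem_Ioi.1 hy).le m)))

theorem postedRevenue_priceLaw (hφ : IsDispersionFunction φ) (hα : 0 < α) (hαβ : α < β) {y : ℝ}
    (hy : α ≤ y) : postedRevenue (priceLaw φ m α β) y = pricePotential φ m α β (min β y) := by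
  have hc := hφ.continuous_deriv
  have hle : α ≤ min β y := le_min hαβ.le hy
  rw [postedRevenue, ← integral_indicator measurableSet_Iic, integral_priceLaw hφ hα hαβ]
  have e : (fun p => priceDensity φ m α β p * (Iic y).indicator (fun p => p) p) =
      (Icc α (min β y)).indicator
        fun p => priceFactor φ m α β * (deriv φ (β - m) - deriv φ (p - m)) := by
    funext p
    have hiff : p ∈ Icc α (min β y) ↔ p ∈ Icc α β ∧ p ∈ Iic y := by
      simp [mem_Icc, and_assoc]
    by_cases h1 : p ∈ Icc α β <;> by_cases h2 : p ∈ Iic y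
    · have hp : p ≠ 0 := (hα.trans_le h1.1).ne'
      rw [priceDensity, indicator_of_mem h1, indicator_of_mem h2,
        indicator_of_mem (hiff.2 ⟨h1, h2⟩)]
      field_simp
    all_goals
      have h3 : p ∉ Icc α (min β y) := fun h => by have := hiff.1 h; tauto
      rw [indicator_of_notMem h3]
      first
        | rw [indicator_of_notMem h2, mul_zero]
        | rw [priceDensity, indicator_of_notMem h1, zero_mul]
  rw [e, integral_indicator measurableSet_Icc, integral_Icc_eq_integral_Ioc,
    ← intervalIntegral.integral_of_le hle, intervalIntegral.integral_eq_sub_of_hasDerivAt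
    (fun x _ => hasDerivAt_pricePotential hφ x)
    (Continuous.intervalIntegrable (by fun_prop) _ _), pricePotential_left, sub_zero]

/-- Below `α` the potential is nonpositive; above `β` it falls while revenue stays constant. -/
theorem pricePotential_le_postedRevenue (hφ : IsDispersionFunction φ) (hα : 0 < α) (hαβ : α < β)
    (y : ℝ) : pricePotential φ m α β y ≤ postedRevenue (priceLaw φ m α β) y := by
  rcases le_total y α with h | h
  · refine le_trans ?_ ((isPriceDistribution_priceLaw hφ hα hαβ).postedRevenue_nonneg y)
    rw [← pricePotential_left (φ := φ) (m := m) (α := α) (β := β)]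
    exact monotoneOn_pricePotential hφ hα hαβ (h.trans hαβ.le) hαβ.le h
  · rw [postedRevenue_priceLaw hφ hα hαβ h]
    rcases le_total y β with h' | h'
    · rw [min_eq_right h']
    · rw [min_eq_left h']
      exact antitoneOn_pricePotential hφ hα hαβ (mem_Ici.2 le_rfl) h' h'

/-- The integration-by-parts formula turns the expectation into `α λ` times the integral that
defines `1/λ`. -/
theorem integral_postedRevenue_paretoLaw (hφ : IsDispersionFunction φ) (hα : 0 < α)
    (hαβ : α < β) :
    ∫ x, postedRevenue (priceLaw φ m α β) (min (α * x) β) ∂paretoLaw = α := by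
  have hc := hφ.continuous_deriv
  have e : ∀ᵐ x ∂paretoLaw, postedRevenue (priceLaw φ m α β) (min (α * x) β) =
      pricePotential φ m α β (min (α * x) β) := by
    filter_upwards [ae_one_le_paretoLaw] with x hx
    rw [postedRevenue_priceLaw hφ hα hαβ (le_min (by nlinarith) hαβ.le),
      min_eq_right (min_le_right _ _)]
  rw [integral_congr_ae e, integral_comp_min_paretoLaw (hasDerivAt_pricePotential hφ)
    (by fun_prop) hα hαβ.le, pricePotential_left]
  simp only [mul_div_assoc]
  rw [intervalIntegral.integral_const_mul, priceFactor,
    one_div_mul_cancel (hφ.deriv_gap_pos m hα hαβ).ne']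
  ring

/-- The expected potential depends only on the mean and the dispersion of the value. -/
theorem integral_pricePotential {Ω : Type*} [MeasurableSpace Ω] {μ : Measure Ω}
    [IsProbabilityMeasure μ] {X : Ω → ℝ} (hX : Integrable X μ)
    (hφX : Integrable (fun ω => φ (X ω - m)) μ) :
    Integrable (fun ω => pricePotential φ m α β (X ω)) μ ∧
    ∫ ω, pricePotential φ m α β (X ω) ∂μ = priceFactor φ m α β *
      (deriv φ (β - m) * (∫ ω, X ω ∂μ - α) - (∫ ω, φ (X ω - m) ∂μ - φ (α - m))) := by
  have h1 : Integrable (fun ω => deriv φ (β - m) * (X ω - α)) μ :=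
    (hX.sub (integrable_const α)).const_mul _
  have h2 : Integrable (fun ω => φ (X ω - m) - φ (α - m)) μ := hφX.sub (integrable_const _)
  refine ⟨(h1.sub h2).const_mul _, ?_⟩
  simp only [pricePotential]
  rw [integral_const_mul, integral_sub h1 h2, integral_const_mul,
    integral_sub hX (integrable_const α), integral_sub hφX (integrable_const _)]
  simp

/-- A random price of law `priceLaw φ m α β` guarantees revenue `α` for all values with the
calibrated mean and dispersion. -/
theorem IsCalibrated.le_integral_postedRevenue (hφ : IsDispersionFunction φ) {s : ℝ}
    (h : IsCalibrated φ m s α β) {Ω : Type*} [MeasurableSpace Ω] {μ : Measure Ω}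
    [IsProbabilityMeasure μ] {X : Ω → ℝ} (hX0 : ∀ ω, 0 ≤ X ω) (hXi : Integrable X μ)
    (hφX : Integrable (fun ω => φ (X ω - m)) μ) (hmean : ∫ ω, X ω ∂μ = m)
    (hdisp : ∫ ω, φ (X ω - m) ∂μ = s) :
    Integrable (fun ω => postedRevenue (priceLaw φ m α β) (X ω)) μ ∧
    α ≤ ∫ ω, postedRevenue (priceLaw φ m α β) (X ω) ∂μ := by
  have hαβ := h.lt_mean.trans h.mean_lt
  have hG := isPriceDistribution_priceLaw (m := m) hφ h.pos hαβ
  have hK := integral_pricePotential (α := α) (β := β) hXi hφX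
  have hcφ : Continuous φ := hφ.differentiable.continuous
  have hK' := integral_pricePotential (φ := φ) (m := m) (α := α) (β := β) (μ := paretoLaw)
    (X := fun x => min (α * x) β)
    (integrable_comp_min_paretoLaw (ψ := fun y => y) (by fun_prop) h.pos hαβ.le)
    (integrable_comp_min_paretoLaw (ψ := fun y => φ (y - m)) (by fun_prop) h.pos hαβ.le)
  have hi : Integrable (fun ω => postedRevenue (priceLaw φ m α β) (X ω)) μ := by
    have hb := hG.isProbabilityMeasure
    refine hXi.mono' (hG.monotone_postedRevenue.measurable.comp_aemeasurable
      hXi.aemeasurable).aestronglyMeasurable (ae_of_all _ fun ω => ?_)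
    rw [Real.norm_of_nonneg (hG.postedRevenue_nonneg _)]
    have h1 := hG.ir (X ω)
    have h2 := mul_le_of_le_one_right (hX0 ω)
      (measureReal_le_one (μ := priceLaw φ m α β) (s := Iic (X ω)))
    linarith
  refine ⟨hi, ?_⟩
  calc α = ∫ x, postedRevenue (priceLaw φ m α β) (min (α * x) β) ∂paretoLaw :=
        (integral_postedRevenue_paretoLaw hφ h.pos hαβ).symm
    _ = ∫ x, pricePotential φ m α β (min (α * x) β) ∂paretoLaw := by
        refine integral_congr_ae ?_
        filter_upwards [ae_one_le_paretoLaw] with x hx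
        have := h.pos
        rw [postedRevenue_priceLaw hφ h.pos hαβ (le_min (by nlinarith) hαβ.le),
          min_eq_right (min_le_right _ _)]
    _ = ∫ ω, pricePotential φ m α β (X ω) ∂μ := by
        -- Both expectations are the same function of mean and dispersion, and these agree.
        rw [hK.2, hK'.2, hmean, hdisp, h.mean_eq, h.dispersion_eq]
    _ ≤ _ := integral_mono hK.1 hi fun ω => pricePotential_le_postedRevenue hφ h.pos hαβ _

end PriceLaw

/-! ### The saddle points -/

variable {n : ℕ}

theorem isProbabilityMeasure_separateWorstCase (α β : Fin n → ℝ) :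
    IsProbabilityMeasure (separateWorstCase α β) :=
  Measure.isProbabilityMeasure_map (measurable_truncatedProfile α β).aemeasurable

theorem integrable_separateWorstCase_iff (α β : Fin n → ℝ) {f : Values n → ℝ}
    (hf : Measurable f) : Integrable f (separateWorstCase α β) ↔
      Integrable (fun x => f (truncatedProfile α β x)) paretoLaw :=
  integrable_map_measure hf.aestronglyMeasurable (measurable_truncatedProfile α β).aemeasurable

theorem ae_coe_truncatedProfile {α β : Fin n → ℝ} (hα : ∀ i, 0 < α i) (hβ : ∀ i, 0 < β i) :
    ∀ᵐ x ∂paretoLaw, ∀ i, (truncatedProfile α β x i : ℝ) = min (α i * x) (β i) := by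
  filter_upwards [ae_one_le_paretoLaw] with x hx i
  exact coe_truncatedProfile (hα i) (hβ i) (zero_le_one.trans hx)

theorem ae_sum_truncatedProfile {m : Fin n → ℝ} (hm : ∀ i, 0 < m i) (hM : 0 < ∑ i, m i)
    {α β : ℝ} (hα : 0 < α) (hβ : 0 < β) : ∀ᵐ x ∂paretoLaw,
      (∀ i, (truncatedProfile (fun i => α * (m i / ∑ j, m j)) (fun i => β * (m i / ∑ j, m j)) x i
        : ℝ) = min (α * x) β * (m i / ∑ j, m j)) ∧
      ∑ i, (truncatedProfile (fun i => α * (m i / ∑ j, m j)) (fun i => β * (m i / ∑ j, m j)) x i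
        : ℝ) = min (α * x) β := by
  have hw : ∀ i, 0 < m i / ∑ j, m j := fun i => div_pos (hm i) hM
  filter_upwards [ae_coe_truncatedProfile (fun i => mul_pos hα (hw i))
    (fun i => mul_pos hβ (hw i))] with x hx
  have h : ∀ i, (truncatedProfile (fun i => α * (m i / ∑ j, m j))
      (fun i => β * (m i / ∑ j, m j)) x i : ℝ) = min (α * x) β * (m i / ∑ j, m j) := fun i => by
    rw [hx i, min_mul_of_nonneg _ _ (hw i).le]
    ring_nf
  refine ⟨h, ?_⟩
  simp only [h]
  rw [← Finset.mul_sum, ← Finset.sum_div, div_self hM.ne', mul_one]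

/-- Scaling a truncated variable scales both bounds, which brings the bundled case under the
seller's bound for separate truncations. -/
theorem bundleWorstCase_eq {m : Fin n → ℝ} (hm : ∀ i, 0 < m i) (hM : 0 < ∑ i, m i) (α β : ℝ) :
    bundleWorstCase m α β =
      separateWorstCase (fun i => α * (m i / ∑ j, m j)) (fun i => β * (m i / ∑ j, m j)) := by
  rw [bundleWorstCase, separateWorstCase]
  congr 1
  funext x i
  rw [min_mul_of_nonneg _ _ (div_pos (hm i) hM).le]
  ring_nf

/-! ### Item-wise dispersion moments and separate sales -/

theorem revenue_separateOptimal {φ : Fin n → ℝ → ℝ} {m s α β : Fin n → ℝ}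
    (hφ : ∀ i, IsDispersionFunction (φ i))
    (h : ∀ i, IsCalibrated (φ i) (m i) (s i) (α i) (β i)) :
    revenue (separateOptimal φ m α β) (separateWorstCase α β) = ∑ i, α i := by
  have hαβ := fun i => (h i).lt_mean.trans (h i).mean_lt
  have hG := fun i => isPriceDistribution_priceLaw (m := m i) (hφ i) (h i).pos (hαβ i)
  have hci : ∀ i, Continuous fun y => φ i (y - m i) := fun i =>
    (hφ i).differentiable.continuous.comp (continuous_id.sub continuous_const)
  rw [revenue, separateOptimal,
    integral_separateWorstCase α β (feasible_separateMechanism hG).measurable_t]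
  simp only [separateMechanism_t]
  have e : ∀ᵐ x ∂paretoLaw,
      ∑ i, postedRevenue (priceLaw (φ i) (m i) (α i) (β i)) (truncatedProfile α β x i) =
      ∑ i, postedRevenue (priceLaw (φ i) (m i) (α i) (β i)) (min (α i * x) (β i)) := by
    filter_upwards [ae_coe_truncatedProfile (fun i => (h i).pos)
      (fun i => (h i).pos.trans (hαβ i))] with x hx
    simp only [hx]
  rw [integral_congr_ae e, integral_finsetSum]
  · exact Finset.sum_congr rfl fun i _ =>
      integral_postedRevenue_paretoLaw (hφ i) (h i).pos (hαβ i)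
  · intro i _
    have hm := (hG i).monotone_postedRevenue
    refine Integrable.of_bound (hm.measurable.comp (by fun_prop)).aestronglyMeasurable
      (postedRevenue (priceLaw (φ i) (m i) (α i) (β i)) (β i)) (ae_of_all _ fun x => ?_)
    rw [Real.norm_of_nonneg ((hG i).postedRevenue_nonneg _)]
    exact hm (min_le_right _ _)

theorem separateWorstCase_mem {φ : Fin n → ℝ → ℝ} {m s α β : Fin n → ℝ}
    (hφ : ∀ i, IsDispersionFunction (φ i))
    (h : ∀ i, IsCalibrated (φ i) (m i) (s i) (α i) (β i)) :
    separateWorstCase α β ∈ itemAmbiguitySet φ m s := by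
  have hαβ := fun i => (h i).lt_mean.trans (h i).mean_lt
  have hae := ae_coe_truncatedProfile (fun i => (h i).pos) (fun i => (h i).pos.trans (hαβ i))
  have hmean : ∀ i, mean (separateWorstCase α β) i = m i := fun i => by
    rw [mean, integral_separateWorstCase α β (measurable_coe_apply i), ← (h i).mean_eq]
    exact integral_congr_ae (hae.mono fun x hx => hx i)
  refine ⟨isProbabilityMeasure_separateWorstCase α β, fun i => ⟨?_, hmean i, ?_⟩⟩
  · rw [integrable_separateWorstCase_iff α β (measurable_coe_apply i)]
    refine (integrable_comp_min_paretoLaw (ψ := fun y => y) continuous_id (h i).pos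
      (hαβ i).le).congr ?_
    exact hae.mono fun x hx => (hx i).symm
  · have hc : Continuous fun y => φ i (y - m i) :=
      (hφ i).differentiable.continuous.comp (continuous_id.sub continuous_const)
    have hm : Measurable fun v : Values n => φ i ((v i : ℝ) - m i) :=
      hc.measurable.comp (measurable_coe_apply i)
    rw [hmean i, integrable_separateWorstCase_iff α β hm, integral_separateWorstCase α β hm,
      ← (h i).dispersion_eq]
    constructor
    · refine (integrable_comp_min_paretoLaw hc (h i).pos (hαβ i).le).congr ?_
      exact hae.mono fun x hx => by simp only [hx i]
    · exact integral_congr_ae (hae.mono fun x hx => by simp only [hx i])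

theorem isSaddlePoint_separate {φ : Fin n → ℝ → ℝ} {m s α β : Fin n → ℝ}
    (hφ : ∀ i, IsDispersionFunction (φ i))
    (h : ∀ i, IsCalibrated (φ i) (m i) (s i) (α i) (β i)) :
    IsSaddlePoint (itemAmbiguitySet φ m s) (separateOptimal φ m α β)
      (separateWorstCase α β) where
  feasible := feasible_separateMechanism fun i =>
    isPriceDistribution_priceLaw (hφ i) (h i).pos ((h i).lt_mean.trans (h i).mean_lt)
  mem := separateWorstCase_mem hφ h
  seller M' hM' := by
    rw [revenue_separateOptimal hφ h]
    exact revenue_separateWorstCase_le (fun i => (h i).pos)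
      (fun i => (h i).pos.trans ((h i).lt_mean.trans (h i).mean_lt)) hM'
  nature F hF := by
    obtain ⟨hP, hF⟩ := hF
    -- The bound is applied to each marginal of `F`; the dependence between items plays no role.
    have key := fun i => (h i).le_integral_postedRevenue (hφ i) (μ := F)
      (X := fun v : Values n => (v i : ℝ)) (fun v => (v i).2) (hF i).1
      ((hF i).2.1 ▸ (hF i).2.2.1) (hF i).2.1 ((hF i).2.1 ▸ (hF i).2.2.2)
    rw [revenue_separateOptimal hφ h, revenue, separateOptimal]
    simp only [separateMechanism_t]
    rw [integral_finsetSum _ fun i _ => (key i).1]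
    exact Finset.sum_le_sum fun i _ => (key i).2

/-! ### Dispersion of the total value and pure bundling -/

theorem revenue_bundleOptimal {φ : ℝ → ℝ} {m : Fin n → ℝ} {s α β : ℝ} (hm : ∀ i, 0 < m i)
    (hM : 0 < ∑ i, m i) (hφ : IsDispersionFunction φ) (h : IsCalibrated φ (∑ i, m i) s α β) :
    revenue (bundleOptimal φ m α β) (bundleWorstCase m α β) = α := by
  have hαβ := h.lt_mean.trans h.mean_lt
  have hG := isPriceDistribution_priceLaw (m := ∑ i, m i) hφ h.pos hαβ
  rw [revenue, bundleOptimal, bundleWorstCase_eq hm hM,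
    integral_separateWorstCase _ _ (feasible_bundleMechanism hG).measurable_t]
  simp only [bundleMechanism_t]
  refine Eq.trans (integral_congr_ae ?_)
    (integral_postedRevenue_paretoLaw (m := ∑ i, m i) hφ h.pos hαβ)
  filter_upwards [ae_sum_truncatedProfile hm hM h.pos (h.pos.trans hαβ)] with x hx
  rw [hx.2]

theorem bundleWorstCase_mem {φ : ℝ → ℝ} {m : Fin n → ℝ} {s α β : ℝ} (hm : ∀ i, 0 < m i)
    (hM : 0 < ∑ i, m i) (hφ : IsDispersionFunction φ) (h : IsCalibrated φ (∑ i, m i) s α β) :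
    bundleWorstCase m α β ∈ totalAmbiguitySet φ m s := by
  have hαβ := h.lt_mean.trans h.mean_lt
  have hae := ae_sum_truncatedProfile hm hM h.pos (h.pos.trans hαβ)
  rw [bundleWorstCase_eq hm hM]
  have hmean : ∀ i, mean (separateWorstCase (fun i => α * (m i / ∑ j, m j))
      (fun i => β * (m i / ∑ j, m j))) i = m i := fun i => by
    rw [mean, integral_separateWorstCase _ _ (measurable_coe_apply i),
      integral_congr_ae (hae.mono fun x hx => hx.1 i), integral_mul_const, h.mean_eq,
      mul_div_cancel₀ _ hM.ne']
  refine ⟨isProbabilityMeasure_separateWorstCase _ _, fun i => ⟨?_, hmean i⟩, ?_⟩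
  · rw [integrable_separateWorstCase_iff _ _ (measurable_coe_apply i)]
    refine ((integrable_comp_min_paretoLaw (ψ := fun y => y) continuous_id h.pos
      hαβ.le).mul_const (m i / ∑ j, m j)).congr ?_
    exact hae.mono fun x hx => (hx.1 i).symm
  · simp only [hmean]
    have hc : Continuous fun y => φ (y - ∑ i, m i) :=
      hφ.differentiable.continuous.comp (continuous_id.sub continuous_const)
    have hφm : Measurable fun v : Values n => φ (∑ i, (v i : ℝ) - ∑ i, m i) :=
      hc.measurable.comp (Finset.measurable_sum _ fun i _ => measurable_coe_apply i)
    rw [integrable_separateWorstCase_iff _ _ hφm, integral_separateWorstCase _ _ hφm,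
      ← h.dispersion_eq]
    constructor
    · refine (integrable_comp_min_paretoLaw hc h.pos hαβ.le).congr ?_
      exact hae.mono fun x hx => by simp only [hx.2]
    · exact integral_congr_ae (hae.mono fun x hx => by simp only [hx.2])

theorem isSaddlePoint_bundle {φ : ℝ → ℝ} {m : Fin n → ℝ} {s α β : ℝ} (hm : ∀ i, 0 < m i)
    (hM : 0 < ∑ i, m i) (hφ : IsDispersionFunction φ) (h : IsCalibrated φ (∑ i, m i) s α β) :
    IsSaddlePoint (totalAmbiguitySet φ m s) (bundleOptimal φ m α β)
      (bundleWorstCase m α β) where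
  feasible := feasible_bundleMechanism
    (isPriceDistribution_priceLaw hφ h.pos (h.lt_mean.trans h.mean_lt))
  mem := bundleWorstCase_mem hm hM hφ h
  seller M' hM' := by
    have hw : ∀ i, 0 < m i / ∑ j, m j := fun i => div_pos (hm i) hM
    rw [revenue_bundleOptimal hm hM hφ h, bundleWorstCase_eq hm hM]
    -- The lower ends are the shares `α m_i / ∑ m_j`, which sum to `α`. Hence even mechanisms that
    -- do not bundle earn at most `α`.
    refine (revenue_separateWorstCase_le (fun i => mul_pos h.pos (hw i))
      (fun i => mul_pos (h.pos.trans (h.lt_mean.trans h.mean_lt)) (hw i)) hM').trans_eq ?_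
    rw [← Finset.mul_sum, ← Finset.sum_div, div_self hM.ne', mul_one]
  nature F hF := by
    obtain ⟨hP, hmean, hφi, hφs⟩ := hF
    simp only [fun i => (hmean i).2] at hφi hφs
    rw [revenue_bundleOptimal hm hM hφ h]
    refine (h.le_integral_postedRevenue hφ (μ := F) (X := fun v : Values n => ∑ i, (v i : ℝ))
      (fun v => Finset.sum_nonneg fun i _ => (v i).2)
      (integrable_finsetSum _ fun i _ => (hmean i).1) hφi ?_ hφs).2
    rw [integral_finsetSum _ fun i _ => (hmean i).1]
    exact Finset.sum_congr rfl fun i _ => (hmean i).2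

end RobustSale

theorem proposition1 (n : ℕ) (hn : 0 < n) (m : Fin n → ℝ) (hm : ∀ i, 0 < m i) :
    -- exact item means and item-wise dispersion moments
    (∀ (φ : Fin n → ℝ → ℝ) (s : Fin n → ℝ),
      (∀ i, IsDispersionFunction (φ i)) → (∀ i, 0 < s i) →
      (∀ i, ∃! p : ℝ × ℝ, IsCalibrated (φ i) (m i) (s i) p.1 p.2) ∧
      ∀ α β : Fin n → ℝ, (∀ i, IsCalibrated (φ i) (m i) (s i) (α i) (β i)) →
        (∀ i, IsProbabilityMeasure (priceLaw (φ i) (m i) (α i) (β i))) ∧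
        separateOptimal φ m α β = randomPriceMechanism
          (Measure.pi fun i => priceLaw (φ i) (m i) (α i) (β i)) ∧
        IsSeparateSales (separateOptimal φ m α β) ∧
        IsSaddlePoint (itemAmbiguitySet φ m s) (separateOptimal φ m α β)
          (separateWorstCase α β) ∧
        revenue (separateOptimal φ m α β) (separateWorstCase α β) = ∑ i, α i ∧
        IsRobustlyOptimal (itemAmbiguitySet φ m s) (separateOptimal φ m α β) ∧
        optimalRevenueGuarantee (itemAmbiguitySet φ m s) = ((∑ i, α i : ℝ) : EReal)) ∧
    -- exact item means and a dispersion moment of the total value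
    (∀ (φ : ℝ → ℝ) (s : ℝ), IsDispersionFunction φ → 0 < s →
      (∃! p : ℝ × ℝ, IsCalibrated φ (∑ i, m i) s p.1 p.2) ∧
      ∀ α β : ℝ, IsCalibrated φ (∑ i, m i) s α β →
        IsProbabilityMeasure (priceLaw φ (∑ i, m i) α β) ∧
        IsPureBundling (bundleOptimal φ m α β) ∧
        IsSaddlePoint (totalAmbiguitySet φ m s) (bundleOptimal φ m α β)
          (bundleWorstCase m α β) ∧
        revenue (bundleOptimal φ m α β) (bundleWorstCase m α β) = α ∧
        IsRobustlyOptimal (totalAmbiguitySet φ m s) (bundleOptimal φ m α β) ∧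
        optimalRevenueGuarantee (totalAmbiguitySet φ m s) = (α : EReal)) := by
  have hM : 0 < ∑ i, m i :=
    Finset.sum_pos (fun i _ => hm i) ⟨⟨0, hn⟩, Finset.mem_univ _⟩
  refine ⟨fun φ s hφ hs => ⟨fun i => existsUnique_isCalibrated (hφ i) (hm i) (hs i),
    fun α β h => ?_⟩, fun φ s hφ hs => ⟨existsUnique_isCalibrated hφ hM hs, fun α β h => ?_⟩⟩
  · have hG := fun i => isPriceDistribution_priceLaw (m := m i) (hφ i) (h i).pos
      ((h i).lt_mean.trans (h i).mean_lt)
    have hsaddle := isSaddlePoint_separate hφ h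
    have hrev := revenue_separateOptimal hφ h
    exact ⟨fun i => (hG i).isProbabilityMeasure, separateMechanism_eq_randomPriceMechanism hG,
      isSeparateSales_separateMechanism hn hG, hsaddle, hrev, hsaddle.isRobustlyOptimal,
      hrev ▸ hsaddle.optimalRevenueGuarantee_eq⟩
  · have hG := isPriceDistribution_priceLaw (m := ∑ i, m i) hφ h.pos
      (h.lt_mean.trans h.mean_lt)
    have hsaddle := isSaddlePoint_bundle hm hM hφ h
    have hrev := revenue_bundleOptimal hm hM hφ h
    have hopt := hsaddle.optimalRevenueGuarantee_eq
    rw [hrev] at hopt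
    exact ⟨hG.isProbabilityMeasure, isPureBundling_bundleMechanism hn hG, hsaddle, hrev,
      hsaddle.isRobustlyOptimal, hopt⟩
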